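/- **Game.** Let $(\mathcal V,\mathcal E,w)$ be a finite directed graph with weights $w>0$ on its edges, $\mathcal N(s)$ the out-neighbors of $s$, $\Theta\subseteq\mathcal V$ a nonempty, linearly ordered set of goals, $r^\theta\ge 0$ ($\theta\in\Theta$) an initial allocation and $s_0\in\mathcal V$. Assume that every goal can be reached from every node that is reachable from $s_0$, and that $r^{s_0}=0$ if $s_0\in\Theta$. Let $\mathcal H_t$ be the set of walks $h_t=(s_0,\dots,s_t)$ of the graph (histories). Put $\mathcal A^\theta(s)=\mathcal N(s)$ if $s\ne\theta$ and $\mathcal A^\theta(\theta)=\{\theta\}$. An Attacker strategy $\gamma=(\gamma_{\rm type},(\gamma^\theta)_{\theta\in\Theta})$ consists of a distribution $\gamma_{\rm type}$ on $\Theta$ and of distributions $\gamma^\theta_{h_t}$ on $\mathcal A^\theta(s_t)$ for all histories; it is admissible ($\gamma\in\Gamma$) if, for every $\theta\in\Theta$, type $\theta$ almost surely has $T^\theta=\min\{t: s_t=\theta\}<\infty$. A Defender strategy $\pi\in\Pi$ consists of distributions $\pi_{h_t}$ on $\Theta$. At each time both players act simultaneously and independently, given the history (and the type, for the Attacker). With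 $l^\theta(s,s',a)=w(s,s')$ if $a=\theta$ and $0$ otherwise, put $J^\theta(\pi,\gamma^\theta)=\mathbb E\big[\sum_{t<T^\theta} l^\theta(s_t,s_{t+1},a_t)\big]+r^\theta$ and $J(\pi,\gamma)=\sum_\theta\gamma_{\rm type}(\theta)J^\theta(\pi,\gamma^\theta)$. **Default strategies.** $\tilde\pi_{h_t}$ puts mass $1$ on the goal closest to $s_t$ in the weighted shortest-path distance of the graph (ties: the smallest goal). $V^\theta(s)$ is the least total cost of a walk from $s$ to $\theta$ when an edge $(u,u')$ costs $w(u,u')$ if $\tilde\pi$ allocates to $\theta$ at $u$, and $0$ otherwise. $\tilde\gamma^\theta$ is any deterministic stationary policy that from every node from which $\theta$ can be reached leads to $\theta$ at total cost $V^\theta$. **Restricted game.** Let $\hat{\mathcal H}$ be a finite set of histories. A history $h\in\hat{\mathcal H}$ is *terminal for* $\theta$ if it visits $\theta$, a *frontier* history for $\theta$ if it does not visit $\theta$ and no one-step extension of it lies in $\hat{\mathcal H}$, and *final for* $\theta$ if it is one of the two. For $h=h_t\in\hat{\mathcal H}$, $a\in\Theta$ and $s'\in\mathcal A^\theta(s_t)$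 let $[L^\theta_h]_{a,s'}$ be $0$ if $h$ is terminal for $\theta$; $l^\theta(s_t,s',a)+V^\theta(s')$ if $h$ is a frontier history for $\theta$; $l^\theta(s_t,s',a)+r^\theta$ if $h=h_0$ is neither; and $l^\theta(s_t,s',a)$ otherwise. The *Attacker LP* minimizes $\sum_{h\in\hat{\mathcal H}}v_h$ over $\gamma_{\rm type}\in\Delta(\Theta)$, $z^\theta_h\in\mathbb R_{\ge 0}^{\mathcal A^\theta(s_t)}$ and $v_h\in\mathbb R$ ($h=h_t\in\hat{\mathcal H}$), subject to $\mathbf 1^\top z^\theta_{h_0}=\gamma_{\rm type}(\theta)$; $\sum_\theta L^\theta_hz^\theta_h\le v_h\mathbf 1$ for all $h\in\hat{\mathcal H}$; and $\mathbf 1^\top z^\theta_{(h,s')}=z^\theta_h(s')$ for all $h,(h,s')\in\hat{\mathcal H}$ (where $z^\theta_h(s')=0$ if $s'\notin\mathcal A^\theta(s_t)$). A solution gives $\hat\gamma^\theta_h=z^\theta_h/(\mathbf 1^\top z^\theta_h)$ if $\mathbf 1^\top z^\theta_h>0$, and otherwise the uniform distribution on $\mathcal A^\theta(s_t)$. The *Defender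 LP* maximizes $U$ over $\hat\pi_h\in\Delta(\Theta)$, $q^\theta_h\in\mathbb R$ and $U\in\mathbb R$, subject to $q^\theta_{h_0}\ge U$; $L^{\theta\top}_h\hat\pi_h+[q^\theta_{(h,s')}]_{s'\in\mathcal A^\theta(s_t)}\ge q^\theta_h\mathbf 1$ if $h=h_t\in\hat{\mathcal H}$ is not final for $\theta$; and $L^{\theta\top}_h\hat\pi_h\ge q^\theta_h\mathbf 1$ if $h$ is final for $\theta$. **Algorithm.** Start with $\hat{\mathcal H}=\bigcup_{t\le\tau}\mathcal H_t$ for some $\tau>0$ and any optimal solution of the Attacker LP. While, for some type $\theta$, some frontier history $h$ for $\theta$ has $\hat\gamma_{\rm type}(\theta)\,\mathbb P^{\hat\gamma}(h\mid\theta)>0$, add to $\hat{\mathcal H}$ all one-step extensions $(h_t,s')$, $s'\in\mathcal N(s_t)$, of all such histories $h=h_t$, and take any optimal solution of the new Attacker LP. When the loop stops, take any optimal solution of the Defender LP. **Proposition.** Suppose that the algorithm stops, with output $\hat{\mathcal H},\hat\gamma^*,\hat\pi^*$. Let $\pi^*_h=\hat\pi^*_h$ and $\gamma^{*\theta}_h=\hat\gamma^{*\theta}_h$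 for $h\in\hat{\mathcal H}$, $\pi^*_h=\tilde\pi_h$ and $\gamma^{*\theta}_h=\tilde\gamma^\theta_h$ for $h\notin\hat{\mathcal H}$, and $\gamma^*_{\rm type}=\hat\gamma^*_{\rm type}$. Then $(\pi^*,\gamma^*)$ is an exact Nash equilibrium of the original game: $\pi^*\in\Pi$, $\gamma^*\in\Gamma$, $J(\pi^*,\gamma^*)<\infty$, and $$J(\pi,\gamma^*)\le J(\pi^*,\gamma^*)\le J(\pi^*,\gamma)\qquad\text{for all }\pi\in\Pi,\ \gamma\in\Gamma .$$ -/

import Mathlib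

open scoped ENNReal

/-! ## The game -/

/-- Data of the deceptive path planning game: a finite weighted directed graph on the nodes `V`,
candidate goals indexed by the types `ι` (distinct types have distinct goals), the initial
allocation `r` and the initial position `s0` of the Attacker. -/
structure DPPGame (V ι : Type*) where
  /-- `edge s s'` says that `(s, s')` is an edge -/
  edge : V → V → Prop
  /-- edge weights; only the values on edges matter -/
  w : V → V → ℝ
  w_pos : ∀ s s', edge s s' → 0 < w s s'
  /-- the goal of each type -/
  goal : ι ↪ V
  /-- initial allocation -/
  r : ι → ℝ
  r_nonneg : ∀ θ, 0 ≤ r θ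
  /-- initial position -/
  s0 : V

/-- A strategy of the Attacker. A history `(s_0, …, s_t)` is the list `[s_t, …, s_0]`, most recent
position first; `typ θ` is the probability of selecting type `θ` (given the fixed `s_0`), and
`act θ h s'` the probability that type `θ` moves to `s'` after the history `h`. -/
structure AttackerStrategy (V ι : Type*) where
  typ : ι → ℝ
  act : ι → List V → V → ℝ

/-- A strategy of the Defender: `π h a` is the probability of allocating to `a` after `h`. -/
abbrev DefenderStrategy (V ι : Type*) := List V → ι → ℝ

/-- Variables of the Attacker's linear program. -/
structure PrimalVars (V ι : Type*) where
  typ : ι → ℝ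
  z : ι → List V → V → ℝ
  v : List V → ℝ

/-- Variables of the Defender's linear program. -/
structure DualVars (V ι : Type*) where
  pol : List V → ι → ℝ
  q : ι → List V → ℝ
  U : ℝ

namespace DPPGame

noncomputable section

open scoped Classical in
/-- Out-neighbors of `s`. -/
def nbrs {V ι : Type*} [Fintype V] (G : DPPGame V ι) (s : V) : Finset V :=
  Finset.univ.filter (fun s' => G.edge s s')

open scoped Classical in
/-- Action set of type `θ` at position `s`. -/
def actions {V ι : Type*} [Fintype V] (G : DPPGame V ι) (θ : ι) (s : V) : Finset V :=
  if s = G.goal θ then {G.goal θ} else G.nbrs s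

/-- Current position of a (nonempty) history. -/
def pos {V ι : Type*} (G : DPPGame V ι) (h : List V) : V := h.headD G.s0

open scoped Classical in
/-- All one-step extensions of `h` along edges. -/
def children {V ι : Type*} [Fintype V] (G : DPPGame V ι) (h : List V) : Finset (List V) :=
  (G.nbrs (G.pos h)).image (fun s' => s' :: h)

open scoped Classical in
/-- The set of possible histories at time `t`. -/
def hist {V ι : Type*} [Fintype V] (G : DPPGame V ι) : ℕ → Finset (List V)
  | 0 => {[G.s0]}
  | t + 1 => (G.hist t).biUnion G.children

def IsHist {V ι : Type*} [Fintype V] (G : DPPGame V ι) (h : List V) : Prop :=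
  ∃ t, h ∈ G.hist t

/-- `h` is a history that ends at the first visit of the goal of type `θ`, i.e. a history
`(s_0, …, s_t)` with `T^θ = t`. -/
def FirstHit {V ι : Type*} [Fintype V] (G : DPPGame V ι) (θ : ι) (h : List V) : Prop :=
  G.IsHist h ∧ ∃ h', h = G.goal θ :: h' ∧ G.goal θ ∉ h'

/-- Probability of the history `h` when the moves are drawn from `g = γ^θ`. -/
def histProb {V : Type*} (g : List V → V → ℝ) : List V → ℝ
  | [] => 1
  | [_] => 1
  | s' :: s :: h => histProb g (s :: h) * g (s :: h) s'

open scoped Classical in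
/-- `ℙ(T^θ < ∞)` when type `θ` plays `g`. -/
def hitProb {V ι : Type*} [Fintype V] (G : DPPGame V ι) (θ : ι) (g : List V → V → ℝ) : ℝ≥0∞ :=
  ∑' h : List V, if G.FirstHit θ h then ENNReal.ofReal (histProb g h) else 0

/-- Admissible strategies of the Attacker. -/
def IsAttackerStrategy {V ι : Type*} [Fintype V] [Fintype ι] (G : DPPGame V ι)
    (γ : AttackerStrategy V ι) : Prop :=
  γ.typ ∈ stdSimplex ℝ ι ∧
  (∀ θ h, G.IsHist h → γ.act θ h ∈ stdSimplex ℝ V ∧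
    ∀ s', s' ∉ G.actions θ (G.pos h) → γ.act θ h s' = 0) ∧
  ∀ θ, G.hitProb θ (γ.act θ) = 1

/-- Admissible strategies of the Defender. -/
def IsDefenderStrategy {V ι : Type*} [Fintype V] [Fintype ι] (G : DPPGame V ι)
    (π : DefenderStrategy V ι) : Prop :=
  ∀ h, G.IsHist h → π h ∈ stdSimplex ℝ ι

open scoped Classical in
/-- Stage cost of type `θ` on the edge `(s, s')` when the Defender allocates to `a`. -/
def stageCost {V ι : Type*} (G : DPPGame V ι) (θ : ι) (s s' : V) (a : ι) : ℝ :=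
  if a = θ then G.w s s' else 0

/-- A finite play `[(a_{t-1}, s_t), …, (a_0, s_1)]` records the Defender's and the Attacker's
actions, most recent first; `playHist` is its public history. -/
def playHist {V ι : Type*} (G : DPPGame V ι) (ω : List (ι × V)) : List V :=
  ω.map Prod.snd ++ [G.s0]

/-- Probability of a finite play (moves of both players are simultaneous and independent). -/
def playProb {V ι : Type*} (G : DPPGame V ι) (π : DefenderStrategy V ι) (g : List V → V → ℝ) :
    List (ι × V) → ℝ
  | [] => 1
  | (a, s') :: ω => G.playProb π g ω * (π (G.playHist ω) a * g (G.playHist ω) s')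

/-- Cumulative stage cost of a finite play for type `θ`. -/
def playCost {V ι : Type*} (G : DPPGame V ι) (θ : ι) : List (ι × V) → ℝ
  | [] => 0
  | (a, s') :: ω => G.playCost θ ω + G.stageCost θ (G.pos (G.playHist ω)) s' a

open scoped Classical in
/-- Expected total cost of type `θ`: the expectation over the complete plays of type `θ` (those
that end when the goal is reached for the first time), plus the initial allocation. As the goal
is reached almost surely under admissible strategies, these plays carry the whole mass. The
expectation is `∞` if it diverges. -/
def typeCost {V ι : Type*} [Fintype V] (G : DPPGame V ι) (θ : ι) (π : DefenderStrategy V ι)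
    (g : List V → V → ℝ) : ℝ≥0∞ :=
  (∑' ω : List (ι × V), if G.FirstHit θ (G.playHist ω) then
    ENNReal.ofReal (G.playProb π g ω) * ENNReal.ofReal (G.playCost θ ω) else 0)
  + ENNReal.ofReal (G.r θ)

/-- Overall expected cost `J(π, γ; s_0, r)` of the Attacker. -/
def cost {V ι : Type*} [Fintype V] [Fintype ι] (G : DPPGame V ι) (π : DefenderStrategy V ι)
    (γ : AttackerStrategy V ι) : ℝ≥0∞ :=
  ∑ θ, ENNReal.ofReal (γ.typ θ) * G.typeCost θ π (γ.act θ)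

/-- Nash equilibrium: both strategies are admissible and neither player gains by deviating
to an admissible strategy (the Attacker minimizes, the Defender maximizes). -/
def IsNash {V ι : Type*} [Fintype V] [Fintype ι] (G : DPPGame V ι) (π : DefenderStrategy V ι)
    (γ : AttackerStrategy V ι) : Prop :=
  G.IsDefenderStrategy π ∧ G.IsAttackerStrategy γ ∧
  (∀ π', G.IsDefenderStrategy π' → G.cost π' γ ≤ G.cost π γ) ∧
  (∀ γ', G.IsAttackerStrategy γ' → G.cost π γ ≤ G.cost π γ')

/-! ## Default strategies -/

/-- Cost of the walk that starts at `s` and then visits the nodes of the list in order. -/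
def walkCost {V : Type*} (c : V → V → ℝ) : V → List V → ℝ≥0∞
  | _, [] => 0
  | s, s' :: l => ENNReal.ofReal (c s s') + walkCost c s' l

/-- Shortest-path cost from `s` to `g` in the graph for the edge costs `c`
(`∞` if there is no walk). -/
def dist {V ι : Type*} (G : DPPGame V ι) (c : V → V → ℝ) (s g : V) : ℝ≥0∞ :=
  ⨅ l : List V, ⨅ _ : List.IsChain G.edge (s :: l) ∧ (s :: l).getLast? = some g, walkCost c s l

open scoped Classical in
/-- The types whose goals are closest to `s`. -/
def closestSet {V ι : Type*} [Fintype ι] (G : DPPGame V ι) (s : V) : Finset ι :=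
  Finset.univ.filter (fun ψ => ∀ φ, G.dist G.w s (G.goal ψ) ≤ G.dist G.w s (G.goal φ))

theorem closestSet_nonempty {V ι : Type*} [Fintype ι] [Nonempty ι] (G : DPPGame V ι) (s : V) :
    (G.closestSet s).Nonempty := by
  classical
  obtain ⟨ψ, -, hψ⟩ := Finset.exists_min_image (Finset.univ : Finset ι)
    (fun ψ => G.dist G.w s (G.goal ψ)) Finset.univ_nonempty
  exact ⟨ψ, by simpa [closestSet] using fun φ => hψ φ (Finset.mem_univ φ)⟩

/-- The closest goal; ties are broken by the smallest index. -/
def closest {V ι : Type*} [Fintype ι] [LinearOrder ι] [Nonempty ι] (G : DPPGame V ι) (s : V) : ι :=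
  (G.closestSet s).min' (G.closestSet_nonempty s)

/-- The Defender's default strategy. -/
def defaultDefender {V ι : Type*} [Fintype ι] [LinearOrder ι] [Nonempty ι] (G : DPPGame V ι) :
    DefenderStrategy V ι :=
  fun h a => if a = G.closest (G.pos h) then 1 else 0

/-- Expected stage cost of type `θ` on `(s, s')` against the Defender's default strategy
(which depends only on the current position `s`). -/
def mdpCost {V ι : Type*} [Fintype ι] [LinearOrder ι] [Nonempty ι] (G : DPPGame V ι)
    (θ : ι) (s s' : V) : ℝ :=
  ∑ a, G.defaultDefender [s] a * G.stageCost θ s s' a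

/-- Optimal value of the shortest path problem that type `θ` faces from `s` when the Defender
uses its default strategy. -/
def mdpValue {V ι : Type*} [Fintype ι] [LinearOrder ι] [Nonempty ι] (G : DPPGame V ι)
    (θ : ι) (s : V) : ℝ≥0∞ :=
  G.dist (G.mdpCost θ) s (G.goal θ)

/-- `σ` is a deterministic stationary best response to the Defender's default strategy: from
every node from which the goal can be reached, it plays an available action, and following it
leads to the goal at the optimal cost. -/
def IsDefaultAttacker {V ι : Type*} [Fintype V] [Fintype ι] [LinearOrder ι] [Nonempty ι]
    (G : DPPGame V ι) (σ : ι → V → V) : Prop :=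
  ∀ θ s, G.mdpValue θ s ≠ ∞ → σ θ s ∈ G.actions θ s ∧
    ∃ l : List V, List.IsChain (fun x y => x ≠ G.goal θ ∧ y = σ θ x) (s :: l) ∧
      (s :: l).getLast? = some (G.goal θ) ∧ walkCost (G.mdpCost θ) s l = G.mdpValue θ s

/-! ## The restricted game on a finite set `H` of histories -/

/-- Non-terminal histories on the truncation frontier of `H` for type `θ`: the goal of `θ` has not
been visited, and `H` contains no extension of the history. -/
def IsFrontier {V ι : Type*} (G : DPPGame V ι) (H : Finset (List V)) (θ : ι) (h : List V) : Prop :=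
  h ∈ H ∧ G.goal θ ∉ h ∧ ∀ s', s' :: h ∉ H

/-- Final histories of the restricted game for type `θ`: the goal has been visited, or the history
lies on the frontier. -/
def IsFinal {V ι : Type*} (G : DPPGame V ι) (H : Finset (List V)) (θ : ι) (h : List V) : Prop :=
  h ∈ H ∧ (G.goal θ ∈ h ∨ G.IsFrontier H θ h)

open scoped Classical in
/-- Stage cost matrix of type `θ` at `h`, with entry at the Defender's action `a` and the
Attacker's action `s'`. -/
def stageMatrix {V ι : Type*} [Fintype ι] [LinearOrder ι] [Nonempty ι] (G : DPPGame V ι)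
    (H : Finset (List V)) (θ : ι) (h : List V) (a : ι) (s' : V) : ℝ :=
  if G.goal θ ∈ h then 0
  else if G.IsFrontier H θ h then
    G.stageCost θ (G.pos h) s' a + (G.mdpValue θ s').toReal
  else if h = [G.s0] then G.stageCost θ (G.pos h) s' a + G.r θ
  else G.stageCost θ (G.pos h) s' a

/-- Feasibility in the Attacker's linear program. The vector `z θ h` is indexed by the actions of
type `θ` and extended by zero. -/
def PrimalFeasible {V ι : Type*} [Fintype V] [Fintype ι] [LinearOrder ι] [Nonempty ι]
    (G : DPPGame V ι) (H : Finset (List V)) (x : PrimalVars V ι) : Prop :=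
  x.typ ∈ stdSimplex ℝ ι ∧
  (∀ θ, ∑ s' ∈ G.actions θ G.s0, x.z θ [G.s0] s' = x.typ θ) ∧
  (∀ θ, ∀ h ∈ H, ∀ s', 0 ≤ x.z θ h s') ∧
  (∀ θ, ∀ h ∈ H, ∀ s', s' ∉ G.actions θ (G.pos h) → x.z θ h s' = 0) ∧
  (∀ h ∈ H, ∀ a, ∑ θ, ∑ s' ∈ G.actions θ (G.pos h), G.stageMatrix H θ h a s' * x.z θ h s'
    ≤ x.v h) ∧
  (∀ θ, ∀ h ∈ H, ∀ s', s' :: h ∈ H →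
    ∑ s'' ∈ G.actions θ s', x.z θ (s' :: h) s'' = x.z θ h s')

/-- `x` is an optimal solution of the Attacker's linear program. -/
def PrimalOptimal {V ι : Type*} [Fintype V] [Fintype ι] [LinearOrder ι] [Nonempty ι]
    (G : DPPGame V ι) (H : Finset (List V)) (x : PrimalVars V ι) : Prop :=
  G.PrimalFeasible H x ∧
  ∀ y, G.PrimalFeasible H y → ∑ h ∈ H, x.v h ≤ ∑ h ∈ H, y.v h

/-- Feasibility in the Defender's linear program. -/
def DualFeasible {V ι : Type*} [Fintype V] [Fintype ι] [LinearOrder ι] [Nonempty ι]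
    (G : DPPGame V ι) (H : Finset (List V)) (y : DualVars V ι) : Prop :=
  (∀ h ∈ H, y.pol h ∈ stdSimplex ℝ ι) ∧
  (∀ θ, y.U ≤ y.q θ [G.s0]) ∧
  (∀ θ, ∀ h ∈ H, ¬ G.IsFinal H θ h → ∀ s' ∈ G.actions θ (G.pos h),
    y.q θ h ≤ ∑ a, G.stageMatrix H θ h a s' * y.pol h a + y.q θ (s' :: h)) ∧
  (∀ θ h, G.IsFinal H θ h → ∀ s' ∈ G.actions θ (G.pos h),
    y.q θ h ≤ ∑ a, G.stageMatrix H θ h a s' * y.pol h a)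

/-- `y` is an optimal solution of the Defender's linear program. -/
def DualOptimal {V ι : Type*} [Fintype V] [Fintype ι] [LinearOrder ι] [Nonempty ι]
    (G : DPPGame V ι) (H : Finset (List V)) (y : DualVars V ι) : Prop :=
  G.DualFeasible H y ∧ ∀ y', G.DualFeasible H y' → y'.U ≤ y.U

open scoped Classical in
/-- The behavioral strategy of type `θ` in the restricted game, extracted from a solution of the
Attacker's linear program. -/
def restrictedAct {V ι : Type*} [Fintype V] (G : DPPGame V ι) (x : PrimalVars V ι)
    (θ : ι) (h : List V) (s' : V) : ℝ :=
  if s' ∈ G.actions θ (G.pos h) then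
    if 0 < ∑ t ∈ G.actions θ (G.pos h), x.z θ h t then
      x.z θ h s' / ∑ t ∈ G.actions θ (G.pos h), x.z θ h t
    else 1 / ((G.actions θ (G.pos h)).card : ℝ)
  else 0

/-! ## The algorithm -/

open scoped Classical in
/-- Initial set of histories: those reachable by time `τ`. -/
def initHist {V ι : Type*} [Fintype V] (G : DPPGame V ι) (τ : ℕ) : Finset (List V) :=
  (Finset.range (τ + 1)).biUnion G.hist

open scoped Classical in
/-- Frontier histories reached with positive probability by some selected type. -/
def reachedFrontier {V ι : Type*} [Fintype V] (G : DPPGame V ι) (H : Finset (List V))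
    (x : PrimalVars V ι) : Finset (List V) :=
  H.filter (fun h => ∃ θ, G.IsFrontier H θ h ∧ 0 < histProb (G.restrictedAct x θ) h * x.typ θ)

open scoped Classical in
/-- Expansion of the restricted game by one step at every reached frontier history. -/
def expand {V ι : Type*} [Fintype V] (G : DPPGame V ι) (H : Finset (List V))
    (x : PrimalVars V ι) : Finset (List V) :=
  H ∪ (G.reachedFrontier H x).biUnion G.children

/-- `G.Run τ H x`: after finitely many iterations, the algorithm started with horizon `τ` can hold
the set `H` of histories and the optimal solution `x` of the Attacker's linear program on `H`
(the linear programs may return any optimal solution). -/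
inductive Run {V ι : Type*} [Fintype V] [Fintype ι] [LinearOrder ι] [Nonempty ι]
    (G : DPPGame V ι) (τ : ℕ) : Finset (List V) → PrimalVars V ι → Prop
  | init (x : PrimalVars V ι) : G.PrimalOptimal (G.initHist τ) x → Run G τ (G.initHist τ) x
  | step (H : Finset (List V)) (x x' : PrimalVars V ι) : Run G τ H x →
      (G.reachedFrontier H x).Nonempty → G.PrimalOptimal (G.expand H x) x' →
      Run G τ (G.expand H x) x'

/-- The algorithm started with horizon `τ` terminates and can return the set `H` of histories, the
solution `x` of the Attacker's and the solution `y` of the Defender's linear program. -/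
def Output {V ι : Type*} [Fintype V] [Fintype ι] [LinearOrder ι] [Nonempty ι]
    (G : DPPGame V ι) (τ : ℕ) (H : Finset (List V)) (x : PrimalVars V ι) (y : DualVars V ι) :
    Prop :=
  G.Run τ H x ∧ G.reachedFrontier H x = ∅ ∧ G.DualOptimal H y

open scoped Classical in
/-- The Defender's strategy: the output on `H`, the default strategy elsewhere. -/
def finalDefender {V ι : Type*} [Fintype ι] [LinearOrder ι] [Nonempty ι] (G : DPPGame V ι)
    (H : Finset (List V)) (y : DualVars V ι) : DefenderStrategy V ι :=
  fun h => if h ∈ H then y.pol h else G.defaultDefender h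

open scoped Classical in
/-- The Attacker's strategy: the output on `H`, the default strategy `σ` elsewhere. -/
def finalAttacker {V ι : Type*} [Fintype V] (G : DPPGame V ι)
    (H : Finset (List V)) (x : PrimalVars V ι) (σ : ι → V → V) : AttackerStrategy V ι where
  typ := x.typ
  act θ h s' := if h ∈ H then G.restrictedAct x θ h s'
    else if s' = σ θ (G.pos h) then 1 else 0

end

end DPPGame

/-!
The linear program of the Attacker has an optimal value `m`, and that of the Defender, by strong
duality, has the same value. The proof shows that each output strategy guarantees this value in the
original game, which makes the pair an equilibrium:

* against `finalDefender`, every admissible strategy of the Attacker costs at least the value of the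
  Defender's program (`DualFeasible.le_cost`);
* against every strategy of the Defender, `finalAttacker` costs at most the value of the Attacker's
  program (`PrimalFeasible.cost_le`).

For the lower bound, glue the dual variables `q` on `H` to the shortest-path values `V^θ` outside
`H`. The frontier constraints of the program are exactly what makes the result a submartingale, up
to the accumulated costs, under `finalDefender` and any policy of the Attacker. A limit argument
(`IsPolicy.le_of_submartingale`) turns this into a bound on the total cost; the mass of the running
plays vanishes since the goal is reached almost surely, and the costs of the running plays are
dominated by those of the plays that continue them up to the goal.

For the upper bound, the variables `z` are the realization probabilities of the extracted behavioral
strategy. When the algorithm stops, no selected type reaches a frontier history, so the play stays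
in `H` up to the goal, where the constraints of the program bound the expected cost against any
allocation.

Strong duality (`PrimalOptimal.exists_dualFeasible`) combines a minimax theorem, obtained by
separating the convex set of attainable cost vectors from the vectors of smaller total maximum, with
backward induction on `H`: a Defender strategy that guarantees `m` against all flows does so against
the deterministic best response of each type, whose cost is the value of `q` at the root.

The sets `H` produced by the algorithm contain with one child of a history all of its children
(`IsFullTree`); hence a play can leave `H` only through a frontier history.
-/

namespace DPPGame

set_option linter.unusedSectionVars false

section

open scoped Classical

variable {V ι : Type*} [Fintype V] {G : DPPGame V ι}

/-! ### Histories -/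

theorem mem_nbrs {s s' : V} : s' ∈ G.nbrs s ↔ G.edge s s' := by simp [nbrs]

@[simp] theorem pos_cons (s : V) (h : List V) : G.pos (s :: h) = s := rfl

theorem mem_hist_zero {h : List V} : h ∈ G.hist 0 ↔ h = [G.s0] := by simp [hist]

theorem mem_hist_succ {n : ℕ} {h : List V} :
    h ∈ G.hist (n + 1) ↔ ∃ k ∈ G.hist n, ∃ s ∈ G.nbrs (G.pos k), s :: k = h := by
  simp [hist, children]

theorem cons_mem_hist_succ {n : ℕ} {s : V} {h : List V} :
    s :: h ∈ G.hist (n + 1) ↔ h ∈ G.hist n ∧ s ∈ G.nbrs (G.pos h) := by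
  rw [mem_hist_succ]
  constructor
  · rintro ⟨k, hk, s', hs', e⟩
    obtain ⟨rfl, rfl⟩ := List.cons.inj e
    exact ⟨hk, hs'⟩
  · rintro ⟨hk, hs⟩
    exact ⟨h, hk, s, hs, rfl⟩

theorem length_of_mem_hist {n : ℕ} {h : List V} (hh : h ∈ G.hist n) : h.length = n + 1 := by
  induction n generalizing h with
  | zero => rw [mem_hist_zero.1 hh]; rfl
  | succ n ih =>
    obtain ⟨k, hk, s, -, rfl⟩ := mem_hist_succ.1 hh
    simp [ih hk]

theorem mem_hist_unique {n m : ℕ} {h : List V} (hn : h ∈ G.hist n) (hm : h ∈ G.hist m) :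
    n = m := by
  have := length_of_mem_hist hn
  have := length_of_mem_hist hm
  omega

theorem isHist_root : G.IsHist [G.s0] := ⟨0, mem_hist_zero.2 rfl⟩

theorem IsHist.ne_nil {h : List V} (hh : G.IsHist h) : h ≠ [] := by
  obtain ⟨n, hn⟩ := hh
  have := length_of_mem_hist hn
  rintro rfl
  simp at this

theorem IsHist.cons {h : List V} (hh : G.IsHist h) {s : V} (hs : s ∈ G.nbrs (G.pos h)) :
    G.IsHist (s :: h) := by
  obtain ⟨n, hn⟩ := hh
  exact ⟨n + 1, cons_mem_hist_succ.2 ⟨hn, hs⟩⟩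

theorem isHist_cons_iff {s : V} {h : List V} (hne : h ≠ []) :
    G.IsHist (s :: h) ↔ G.IsHist h ∧ s ∈ G.nbrs (G.pos h) := by
  constructor
  · rintro ⟨n, hn⟩
    cases n with
    | zero => exact absurd (List.cons.inj (mem_hist_zero.1 hn)).2 hne
    | succ n =>
      obtain ⟨h1, h2⟩ := cons_mem_hist_succ.1 hn
      exact ⟨⟨n, h1⟩, h2⟩
  · rintro ⟨h1, h2⟩
    exact h1.cons h2

/-- Induction along the one-step extensions of a history. -/
@[elab_as_elim]
theorem IsHist.induction {P : ∀ h, G.IsHist h → Prop} (root : P [G.s0] isHist_root)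
    (step : ∀ h s (hh : G.IsHist h) (hs : s ∈ G.nbrs (G.pos h)), P h hh → P (s :: h) (hh.cons hs))
    {h : List V} (hh : G.IsHist h) : P h hh := by
  obtain ⟨n, hn⟩ := hh
  induction n generalizing h with
  | zero =>
    obtain rfl := mem_hist_zero.1 hn
    exact root
  | succ n ih =>
    obtain ⟨k, hk, s, hs, rfl⟩ := mem_hist_succ.1 hn
    exact step k s ⟨n, hk⟩ hs (ih hk)

theorem IsHist.reachable {h : List V} (hh : G.IsHist h) :
    Relation.ReflTransGen G.edge G.s0 (G.pos h) := by
  induction hh using IsHist.induction with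
  | root => exact .refl
  | step h s _ hs ih => exact ih.tail (mem_nbrs.1 hs)

theorem IsHist.pos_mem {h : List V} (hh : G.IsHist h) : G.pos h ∈ h := by
  have := hh.ne_nil
  cases h with
  | nil => contradiction
  | cons s h => simp

theorem actions_of_ne {θ : ι} {s : V} (h : s ≠ G.goal θ) : G.actions θ s = G.nbrs s := by
  simp [actions, h]

theorem actions_of_notMem {θ : ι} {h : List V} (hh : G.IsHist h) (hg : G.goal θ ∉ h) :
    G.actions θ (G.pos h) = G.nbrs (G.pos h) :=
  actions_of_ne fun e => hg (e ▸ hh.pos_mem)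

theorem actions_nonempty {θ : ι} {s : V} (hs : Relation.ReflTransGen G.edge s (G.goal θ)) :
    (G.actions θ s).Nonempty := by
  by_cases h : s = G.goal θ
  · simp [actions, h]
  · rw [actions_of_ne h]
    obtain e | ⟨t, ht, -⟩ := hs.cases_head
    · exact absurd e h
    · exact ⟨t, mem_nbrs.2 ht⟩

theorem histProb_cons (g : List V → V → ℝ) {h : List V} (hne : h ≠ []) (s : V) :
    histProb g (s :: h) = histProb g h * g h s := by
  cases h with
  | nil => contradiction
  | cons t h => rfl

theorem firstHit_cons {θ : ι} {s : V} {h : List V} :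
    G.FirstHit θ (s :: h) ↔ G.IsHist (s :: h) ∧ s = G.goal θ ∧ G.goal θ ∉ h := by
  constructor
  · rintro ⟨h1, k, e, hk⟩
    obtain ⟨rfl, rfl⟩ := List.cons.inj e
    exact ⟨h1, rfl, hk⟩
  · rintro ⟨h1, rfl, hk⟩
    exact ⟨h1, h, rfl, hk⟩

/-! ### Sums over the histories of a given time -/

theorem sum_hist_succ {M : Type*} [AddCommMonoid M] (n : ℕ) (F : List V → M) :
    ∑ h ∈ G.hist (n + 1), F h = ∑ h ∈ G.hist n, ∑ s ∈ G.nbrs (G.pos h), F (s :: h) := by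
  have e : G.hist (n + 1) = (G.hist n).biUnion G.children := by
    ext h; simp [mem_hist_succ, children]
  rw [e, Finset.sum_biUnion]
  · refine Finset.sum_congr rfl fun h _ => ?_
    rw [children, Finset.sum_image]
    intro a _ b _ hab
    exact (List.cons.inj hab).1
  · intro h _ k _ hne
    rw [Function.onFun, Finset.disjoint_left]
    intro l hl hl'
    simp only [children, Finset.mem_image] at hl hl'
    obtain ⟨a, -, rfl⟩ := hl
    obtain ⟨b, -, e⟩ := hl'
    exact hne (List.cons.inj e).2.symm

/-- Histories of time `n` that have not visited the goal of type `θ`. -/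
noncomputable def alive (G : DPPGame V ι) (θ : ι) (n : ℕ) : Finset (List V) :=
  (G.hist n).filter (fun h => G.goal θ ∉ h)

/-- Histories of time `n` that visit the goal of type `θ` for the first time at time `n`. -/
noncomputable def hits (G : DPPGame V ι) (θ : ι) (n : ℕ) : Finset (List V) :=
  (G.hist n).filter (fun h => G.FirstHit θ h)

theorem mem_alive {θ : ι} {n : ℕ} {h : List V} :
    h ∈ G.alive θ n ↔ h ∈ G.hist n ∧ G.goal θ ∉ h := by simp [alive]

theorem mem_hits {θ : ι} {n : ℕ} {h : List V} :
    h ∈ G.hits θ n ↔ h ∈ G.hist n ∧ G.FirstHit θ h := by simp [hits]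

theorem sum_hits_add_sum_alive {θ : ι} (n : ℕ) (F : List V → ℝ) :
    ∑ h ∈ G.hits θ (n + 1), F h + ∑ h ∈ G.alive θ (n + 1), F h =
      ∑ h ∈ G.alive θ n, ∑ s ∈ G.nbrs (G.pos h), F (s :: h) := by
  rw [hits, alive, alive, Finset.sum_filter, Finset.sum_filter, Finset.sum_filter,
    ← Finset.sum_add_distrib, sum_hist_succ]
  refine Finset.sum_congr rfl fun h hh => ?_
  have key : ∀ s ∈ G.nbrs (G.pos h), ((if G.FirstHit θ (s :: h) then F (s :: h) else 0) +
      if G.goal θ ∉ s :: h then F (s :: h) else 0) = if G.goal θ ∉ h then F (s :: h) else 0 := by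
    intro s hs
    have : G.IsHist (s :: h) := IsHist.cons ⟨n, hh⟩ hs
    by_cases h1 : G.goal θ ∈ h <;> by_cases h2 : s = G.goal θ
    · simp [firstHit_cons, h1]
    · simp [firstHit_cons, h1]
    · simp [firstHit_cons, h1, h2, h2 ▸ this]
    · have h3 : G.goal θ ≠ s := fun e => h2 e.symm
      simp [firstHit_cons, h1, h2, h3]
  rw [Finset.sum_congr rfl key]
  split_ifs <;> simp

/-- `g` is a behavioral policy of type `θ`: a distribution on the available actions after every
history. -/
def IsPolicy (G : DPPGame V ι) (θ : ι) (g : List V → V → ℝ) : Prop :=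
  ∀ h, G.IsHist h → g h ∈ stdSimplex ℝ V ∧ ∀ s, s ∉ G.actions θ (G.pos h) → g h s = 0

namespace IsPolicy

variable {θ : ι} {g : List V → V → ℝ}

theorem nonneg (hg : G.IsPolicy θ g) {h : List V} (hh : G.IsHist h) (s : V) : 0 ≤ g h s :=
  (hg h hh).1.1 s

theorem sum_actions (hg : G.IsPolicy θ g) {h : List V} (hh : G.IsHist h) :
    ∑ s ∈ G.actions θ (G.pos h), g h s = 1 := by
  rw [← (hg h hh).1.2]
  exact Finset.sum_subset (Finset.subset_univ _) fun s _ hs => (hg h hh).2 s hs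

theorem sum_nbrs (hg : G.IsPolicy θ g) {h : List V} (hh : G.IsHist h) (hn : G.goal θ ∉ h) :
    ∑ s ∈ G.nbrs (G.pos h), g h s = 1 := by
  rw [← actions_of_notMem hh hn, hg.sum_actions hh]

theorem histProb_nonneg (hg : G.IsPolicy θ g) {h : List V} (hh : G.IsHist h) :
    0 ≤ histProb g h := by
  induction hh using IsHist.induction with
  | root => simp [histProb]
  | step h s hh hs ih =>
    rw [histProb_cons g hh.ne_nil]
    exact mul_nonneg ih (hg.nonneg hh s)

end IsPolicy

/-- Expectation of `F`, evaluated at the history stopped at the goal of type `θ` or at time `N`. -/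
noncomputable def stopSum (G : DPPGame V ι) (θ : ι) (g : List V → V → ℝ) (N : ℕ)
    (F : List V → ℝ) : ℝ :=
  ∑ n ∈ Finset.range (N + 1), ∑ h ∈ G.hits θ n, histProb g h * F h +
    ∑ h ∈ G.alive θ N, histProb g h * F h

theorem stopSum_zero (θ : ι) (g : List V → V → ℝ) (F : List V → ℝ) :
    G.stopSum θ g 0 F = F [G.s0] := by
  have h0 : G.hist 0 = {[G.s0]} := by ext h; simp [mem_hist_zero]
  by_cases h : G.s0 = G.goal θ
  · have := isHist_root (G := G)
    rw [h] at this
    simp [stopSum, hits, alive, h0, Finset.sum_filter, firstHit_cons, histProb, h, this]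
  · simp [stopSum, hits, alive, h0, Finset.sum_filter, firstHit_cons, histProb, h, Ne.symm h]

/-- The increments of stopped expectations are the expected increments of `F`. -/
theorem stopSum_succ (θ : ι) (g : List V → V → ℝ) (N : ℕ) (F : List V → ℝ) :
    G.stopSum θ g (N + 1) F = G.stopSum θ g N F +
      ∑ h ∈ G.alive θ N, histProb g h * (∑ s ∈ G.nbrs (G.pos h), g h s * F (s :: h) - F h) := by
  have key := sum_hits_add_sum_alive (G := G) (θ := θ) N (fun h => histProb g h * F h)
  have e : ∑ h ∈ G.alive θ N, ∑ s ∈ G.nbrs (G.pos h), histProb g (s :: h) * F (s :: h) =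
      ∑ h ∈ G.alive θ N, histProb g h * ∑ s ∈ G.nbrs (G.pos h), g h s * F (s :: h) := by
    refine Finset.sum_congr rfl fun h hh => ?_
    rw [Finset.mul_sum]
    refine Finset.sum_congr rfl fun s _ => ?_
    rw [histProb_cons g (IsHist.ne_nil ⟨N, (mem_alive.1 hh).1⟩), mul_assoc]
  rw [e] at key
  simp only [mul_sub, Finset.sum_sub_distrib]
  rw [← key, stopSum, stopSum, Finset.sum_range_succ _ (N + 1)]
  ring

theorem stopSum_add (θ : ι) (g : List V → V → ℝ) (N : ℕ) (F F' : List V → ℝ) :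
    G.stopSum θ g N (fun h => F h + F' h) = G.stopSum θ g N F + G.stopSum θ g N F' := by
  simp only [stopSum, mul_add, Finset.sum_add_distrib]
  ring

/-- The probability that type `θ` has not reached its goal by time `n`. -/
noncomputable def aliveProb (G : DPPGame V ι) (θ : ι) (g : List V → V → ℝ) (n : ℕ) : ℝ :=
  ∑ h ∈ G.alive θ n, histProb g h

theorem IsPolicy.stopSum_one {θ : ι} {g : List V → V → ℝ} (hg : G.IsPolicy θ g) (N : ℕ) :
    ∑ n ∈ Finset.range (N + 1), ∑ h ∈ G.hits θ n, histProb g h + G.aliveProb θ g N = 1 := by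
  have : G.stopSum θ g N (fun _ => 1) = 1 := by
    induction N with
    | zero => rw [stopSum_zero]
    | succ N ih =>
      rw [stopSum_succ, ih, add_eq_left]
      refine Finset.sum_eq_zero fun h hh => ?_
      have := mem_alive.1 hh
      simp [hg.sum_nbrs ⟨N, this.1⟩ this.2]
  simpa [stopSum, aliveProb] using this

/-! ### Costs as sums over histories -/

/-- In `ℝ≥0∞`, a sum can be taken along disjoint finite sets that cover the support. -/
theorem tsum_eq_tsum_sum_finset {α : Type*} (F : α → ℝ≥0∞) (s : ℕ → Finset α)
    (hs : ∀ x, F x ≠ 0 → ∃ n, ∀ k, x ∈ s k ↔ k = n) :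
    ∑' x, F x = ∑' n, ∑ x ∈ s n, F x := by
  have e : ∀ n, ∑ x ∈ s n, F x = ∑' x, if x ∈ s n then F x else 0 := by
    intro n
    rw [tsum_eq_sum (s := s n) (fun x hx => if_neg hx)]
    exact Finset.sum_congr rfl fun x hx => (if_pos hx).symm
  simp_rw [e]
  rw [ENNReal.tsum_comm]
  refine tsum_congr fun x => ?_
  by_cases hx : F x = 0
  · simp [hx]
  · obtain ⟨n, hn⟩ := hs x hx
    rw [tsum_eq_single n (fun k hk => if_neg (by rwa [hn])), if_pos ((hn n).2 rfl)]

theorem IsPolicy.hitProb_eq {θ : ι} {g : List V → V → ℝ} (hg : G.IsPolicy θ g) :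
    G.hitProb θ g = ∑' n, ENNReal.ofReal (∑ h ∈ G.hits θ n, histProb g h) := by
  rw [hitProb, tsum_eq_tsum_sum_finset _ (G.hits θ)]
  · refine tsum_congr fun n => ?_
    rw [ENNReal.ofReal_sum_of_nonneg]
    · exact Finset.sum_congr rfl fun h hh => if_pos (mem_hits.1 hh).2
    · exact fun h hh => hg.histProb_nonneg ⟨n, (mem_hits.1 hh).1⟩
  · intro h hne
    have hf : G.FirstHit θ h := by
      by_contra hf
      simp [hf] at hne
    obtain ⟨n, hn⟩ := hf.1
    refine ⟨n, fun k => ⟨fun hk => mem_hist_unique (mem_hits.1 hk).1 hn, ?_⟩⟩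
    rintro rfl
    exact mem_hits.2 ⟨hn, hf⟩

/-- The goal is reached almost surely if and only if the survival probabilities vanish in the
limit. -/
theorem IsPolicy.hitProb_eq_one_iff {θ : ι} {g : List V → V → ℝ} (hg : G.IsPolicy θ g) :
    G.hitProb θ g = 1 ↔ Filter.Tendsto (G.aliveProb θ g) Filter.atTop (nhds 0) := by
  have hnn : ∀ n, 0 ≤ ∑ h ∈ G.hits θ n, histProb g h := fun n =>
    Finset.sum_nonneg fun h hh => hg.histProb_nonneg ⟨n, (mem_hits.1 hh).1⟩
  have lim : Filter.Tendsto (fun N => ENNReal.ofReal (1 - G.aliveProb θ g N)) Filter.atTop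
      (nhds (G.hitProb θ g)) := by
    rw [hg.hitProb_eq]
    have := (ENNReal.tendsto_nat_tsum
      (fun n => ENNReal.ofReal (∑ h ∈ G.hits θ n, histProb g h))).comp
      (Filter.tendsto_add_atTop_nat 1)
    refine this.congr fun N => ?_
    rw [Function.comp_apply, ← ENNReal.ofReal_sum_of_nonneg (fun n _ => hnn n)]
    congr 1
    linarith [hg.stopSum_one N]
  constructor
  · intro h
    rw [h] at lim
    have := (ENNReal.tendsto_toReal ENNReal.one_ne_top).comp lim
    have h2 : Filter.Tendsto (fun N => 1 - G.aliveProb θ g N) Filter.atTop (nhds 1) := by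
      refine this.congr fun N => ?_
      rw [Function.comp_apply, ENNReal.toReal_ofReal]
      have := hg.stopSum_one N
      have := Finset.sum_nonneg fun n (_ : n ∈ Finset.range (N + 1)) => hnn n
      linarith
    simpa using h2.const_sub 1
  · intro h
    have h2 : Filter.Tendsto (fun N => ENNReal.ofReal (1 - G.aliveProb θ g N)) Filter.atTop
        (nhds (ENNReal.ofReal (1 - 0))) := ENNReal.tendsto_ofReal (h.const_sub 1)
    have := tendsto_nhds_unique lim h2
    simpa using this

/-- The finite set of words of length `n` over a finite alphabet. -/
noncomputable def words (α : Type*) [Fintype α] : ℕ → Finset (List α)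
  | 0 => {[]}
  | n + 1 => (words α n).biUnion fun l => Finset.univ.image fun a => a :: l

theorem mem_words {α : Type*} [Fintype α] {n : ℕ} {l : List α} :
    l ∈ words α n ↔ l.length = n := by
  induction n generalizing l with
  | zero => simp [words]
  | succ n ih => cases l <;> simp [words, ih]

theorem sum_words_succ {α M : Type*} [Fintype α] [AddCommMonoid M] (n : ℕ) (F : List α → M) :
    ∑ l ∈ words α (n + 1), F l = ∑ l ∈ words α n, ∑ a, F (a :: l) := by
  rw [words, Finset.sum_biUnion]
  · refine Finset.sum_congr rfl fun l _ => ?_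
    rw [Finset.sum_image]
    intro a _ b _ hab
    exact (List.cons.inj hab).1
  · intro h _ k _ hne
    rw [Function.onFun, Finset.disjoint_left]
    intro l hl hl'
    simp only [Finset.mem_image] at hl hl'
    obtain ⟨a, -, rfl⟩ := hl
    obtain ⟨b, -, e⟩ := hl'
    exact hne (List.cons.inj e).2.symm

variable [Fintype ι]

/-- Expected stage cost of type `θ` for the move to `s` after the history `h`. -/
noncomputable def meanStage (G : DPPGame V ι) (θ : ι) (π : DefenderStrategy V ι) (h : List V)
    (s : V) : ℝ := ∑ a, π h a * G.stageCost θ (G.pos h) s a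

/-- Expected total cost of type `θ`, conditional on the history `h`. -/
noncomputable def meanCost (G : DPPGame V ι) (θ : ι) (π : DefenderStrategy V ι) : List V → ℝ
  | [] => 0
  | [_] => 0
  | s :: t :: h => meanCost G θ π (t :: h) + G.meanStage θ π (t :: h) s

theorem meanCost_cons (θ : ι) (π : DefenderStrategy V ι) {h : List V} (hne : h ≠ []) (s : V) :
    G.meanCost θ π (s :: h) = G.meanCost θ π h + G.meanStage θ π h s := by
  cases h with
  | nil => contradiction
  | cons t h => rfl

theorem stageCost_nonneg {θ : ι} {s s' : V} (h : s' ∈ G.nbrs s) (a : ι) :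
    0 ≤ G.stageCost θ s s' a := by
  unfold stageCost
  split_ifs
  · exact (G.w_pos s s' (mem_nbrs.1 h)).le
  · exact le_rfl

theorem meanStage_nonneg {θ : ι} {π : DefenderStrategy V ι} (hπ : G.IsDefenderStrategy π)
    {h : List V} (hh : G.IsHist h) {s : V} (hs : s ∈ G.nbrs (G.pos h)) :
    0 ≤ G.meanStage θ π h s :=
  Finset.sum_nonneg fun a _ => mul_nonneg ((hπ h hh).1 a) (stageCost_nonneg hs a)

theorem meanCost_nonneg {θ : ι} {π : DefenderStrategy V ι} (hπ : G.IsDefenderStrategy π)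
    {h : List V} (hh : G.IsHist h) : 0 ≤ G.meanCost θ π h := by
  induction hh using IsHist.induction with
  | root => simp [meanCost]
  | step h s hh hs ih =>
    rw [meanCost_cons θ π hh.ne_nil]
    exact add_nonneg ih (meanStage_nonneg hπ hh hs)

@[simp] theorem playHist_nil : G.playHist [] = [G.s0] := rfl

@[simp] theorem playHist_cons (a : ι) (s : V) (ω : List (ι × V)) :
    G.playHist ((a, s) :: ω) = s :: G.playHist ω := rfl

theorem playHist_ne_nil (ω : List (ι × V)) : G.playHist ω ≠ [] := by simp [playHist]

theorem playProb_nonneg {θ : ι} {π : DefenderStrategy V ι} (hπ : G.IsDefenderStrategy π)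
    {g : List V → V → ℝ} (hg : G.IsPolicy θ g) (ω : List (ι × V)) (hω : G.IsHist (G.playHist ω)) :
    0 ≤ G.playProb π g ω := by
  induction ω with
  | nil => simp [playProb]
  | cons p ω ih =>
    obtain ⟨a, s⟩ := p
    rw [playHist_cons, isHist_cons_iff (playHist_ne_nil ω)] at hω
    exact mul_nonneg (ih hω.1) (mul_nonneg ((hπ _ hω.1).1 a) (hg.nonneg hω.1 s))

theorem playCost_nonneg {θ : ι} (ω : List (ι × V)) (hω : G.IsHist (G.playHist ω)) :
    0 ≤ G.playCost θ ω := by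
  induction ω with
  | nil => simp [playCost]
  | cons p ω ih =>
    obtain ⟨a, s⟩ := p
    rw [playHist_cons, isHist_cons_iff (playHist_ne_nil ω)] at hω
    exact add_nonneg (ih hω.1) (stageCost_nonneg hω.2 a)

/-- Summing out the actions of the Defender, which are independent of the moves of the Attacker
given the history. -/
theorem sum_words_playProb {π : DefenderStrategy V ι} (hπ : G.IsDefenderStrategy π)
    (g : List V → V → ℝ) (n : ℕ) (F : List V → ℝ) (hF : ∀ h, ¬ G.IsHist h → F h = 0) :
    ∑ ω ∈ words (ι × V) n, G.playProb π g ω * F (G.playHist ω) =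
      ∑ h ∈ G.hist n, histProb g h * F h := by
  induction n generalizing F with
  | zero => simp [words, playProb, hist, histProb]
  | succ n ih =>
    rw [sum_words_succ, sum_hist_succ]
    have h1 := ih (fun h => if G.IsHist h then ∑ s, g h s * F (s :: h) else 0)
      (fun h hh => if_neg hh)
    calc _ = ∑ ω ∈ words (ι × V) n, G.playProb π g ω * (if G.IsHist (G.playHist ω) then
              ∑ s, g (G.playHist ω) s * F (s :: G.playHist ω) else 0) := ?_
      _ = _ := h1
      _ = _ := ?_
    · refine Finset.sum_congr rfl fun ω _ => ?_
      rw [Fintype.sum_prod_type]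
      simp only [playProb, playHist_cons]
      split_ifs with hh
      · calc _ = ∑ a, π (G.playHist ω) a * (G.playProb π g ω *
                ∑ s, g (G.playHist ω) s * F (s :: G.playHist ω)) := by
              refine Finset.sum_congr rfl fun a _ => ?_
              rw [Finset.mul_sum, Finset.mul_sum]
              exact Finset.sum_congr rfl fun s _ => by ring
          _ = _ := by rw [← Finset.sum_mul, (hπ _ hh).2, one_mul]
      · rw [mul_zero]
        refine Finset.sum_eq_zero fun a _ => Finset.sum_eq_zero fun s _ => ?_
        rw [hF _ fun hc => hh ((isHist_cons_iff (playHist_ne_nil ω)).1 hc).1, mul_zero]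
    · refine Finset.sum_congr rfl fun h hh => ?_
      have hh' : G.IsHist h := ⟨n, hh⟩
      rw [if_pos hh', Finset.mul_sum]
      symm
      refine Finset.sum_subset_zero_on_sdiff (Finset.subset_univ _) (fun s hs => ?_) fun s _ => ?_
      · rw [Finset.mem_sdiff] at hs
        rw [hF _ fun hc => hs.2 ((isHist_cons_iff hh'.ne_nil).1 hc).2, mul_zero, mul_zero]
      · rw [histProb_cons g hh'.ne_nil, mul_assoc]

theorem sum_words_playCost {π : DefenderStrategy V ι} (hπ : G.IsDefenderStrategy π) (θ : ι)
    (g : List V → V → ℝ) (n : ℕ) (F : List V → ℝ) (hF : ∀ h, ¬ G.IsHist h → F h = 0) :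
    ∑ ω ∈ words (ι × V) n, G.playProb π g ω * G.playCost θ ω * F (G.playHist ω) =
      ∑ h ∈ G.hist n, histProb g h * (G.meanCost θ π h * F h) := by
  induction n generalizing F with
  | zero => simp [words, playProb, hist, histProb, playCost, meanCost]
  | succ n ih =>
    rw [sum_words_succ, sum_hist_succ]
    have h1 := ih (fun h => if G.IsHist h then ∑ s, g h s * F (s :: h) else 0)
      (fun h hh => if_neg hh)
    have h2 := sum_words_playProb hπ g n
      (fun h => if G.IsHist h then ∑ s, G.meanStage θ π h s * g h s * F (s :: h) else 0)
      (fun h hh => if_neg hh)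
    calc _ = ∑ ω ∈ words (ι × V) n, G.playProb π g ω * G.playCost θ ω *
              (if G.IsHist (G.playHist ω) then
                ∑ s, g (G.playHist ω) s * F (s :: G.playHist ω) else 0) +
            ∑ ω ∈ words (ι × V) n, G.playProb π g ω * (if G.IsHist (G.playHist ω) then
              ∑ s, G.meanStage θ π (G.playHist ω) s * g (G.playHist ω) s *
                F (s :: G.playHist ω) else 0) := ?_
      _ = _ := congrArg₂ (· + ·) h1 h2
      _ = _ := ?_
    · rw [← Finset.sum_add_distrib]
      refine Finset.sum_congr rfl fun ω _ => ?_
      rw [Fintype.sum_prod_type]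
      simp only [playProb, playCost, playHist_cons]
      split_ifs with hh
      · rw [Finset.sum_comm, Finset.mul_sum, Finset.mul_sum, ← Finset.sum_add_distrib]
        refine Finset.sum_congr rfl fun s _ => ?_
        have e1 := (hπ _ hh).2
        calc _ = (∑ a, π (G.playHist ω) a) * (G.playProb π g ω * G.playCost θ ω *
                  (g (G.playHist ω) s * F (s :: G.playHist ω))) +
                G.meanStage θ π (G.playHist ω) s * (G.playProb π g ω *
                  (g (G.playHist ω) s * F (s :: G.playHist ω))) := by
              rw [meanStage, Finset.sum_mul, Finset.sum_mul, ← Finset.sum_add_distrib]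
              exact Finset.sum_congr rfl fun a _ => by ring
          _ = _ := by rw [e1]; ring
      · rw [mul_zero, mul_zero, add_zero]
        refine Finset.sum_eq_zero fun a _ => Finset.sum_eq_zero fun s _ => ?_
        rw [hF _ fun hc => hh ((isHist_cons_iff (playHist_ne_nil ω)).1 hc).1, mul_zero]
    · rw [← Finset.sum_add_distrib]
      refine Finset.sum_congr rfl fun h hh => ?_
      have hh' : G.IsHist h := ⟨n, hh⟩
      rw [if_pos hh', if_pos hh', Finset.mul_sum, Finset.mul_sum, Finset.mul_sum,
        ← Finset.sum_add_distrib]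
      symm
      refine Finset.sum_subset_zero_on_sdiff (Finset.subset_univ _) (fun s hs => ?_) fun s _ => ?_
      · rw [Finset.mem_sdiff] at hs
        rw [hF _ fun hc => hs.2 ((isHist_cons_iff hh'.ne_nil).1 hc).2]
        ring
      · rw [histProb_cons g hh'.ne_nil, meanCost_cons θ π hh'.ne_nil]
        ring

theorem typeCost_eq {π : DefenderStrategy V ι} (hπ : G.IsDefenderStrategy π) {θ : ι}
    {g : List V → V → ℝ} (hg : G.IsPolicy θ g) :
    G.typeCost θ π g = ∑' n, ENNReal.ofReal (∑ h ∈ G.hits θ n, histProb g h * G.meanCost θ π h) +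
      ENNReal.ofReal (G.r θ) := by
  rw [typeCost, tsum_eq_tsum_sum_finset _ (words (ι × V))
    (fun ω _ => ⟨ω.length, fun k => by rw [mem_words, eq_comm]⟩)]
  congr 1
  refine tsum_congr fun n => ?_
  have h1 := sum_words_playCost hπ θ g n (fun h => if G.FirstHit θ h then 1 else 0)
    (fun h hh => if_neg fun hc => hh hc.1)
  have h2 : ∑ h ∈ G.hits θ n, histProb g h * G.meanCost θ π h =
      ∑ h ∈ G.hist n, histProb g h * (G.meanCost θ π h * if G.FirstHit θ h then 1 else 0) := by
    rw [hits, Finset.sum_filter]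
    exact Finset.sum_congr rfl fun h _ => by split_ifs <;> simp
  rw [h2, ← h1, ENNReal.ofReal_sum_of_nonneg]
  · refine Finset.sum_congr rfl fun ω _ => ?_
    split_ifs with hω
    · rw [mul_one, ENNReal.ofReal_mul (playProb_nonneg hπ hg ω hω.1)]
    · simp
  · intro ω _
    split_ifs with hω
    · rw [mul_one]
      exact mul_nonneg (playProb_nonneg hπ hg ω hω.1) (playCost_nonneg ω hω.1)
    · simp

variable [LinearOrder ι] [Nonempty ι]

/-! ### The sets of histories generated by the algorithm -/

/-- A finite tree of histories that contains all histories of times `0` and `1` and in which every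
node has either none or all of its one-step extensions. -/
structure IsFullTree (G : DPPGame V ι) (H : Finset (List V)) : Prop where
  isHist : ∀ h ∈ H, G.IsHist h
  root : [G.s0] ∈ H
  first : ∀ s ∈ G.nbrs G.s0, [s, G.s0] ∈ H
  tail : ∀ h s, h ≠ [] → s :: h ∈ H → h ∈ H
  full : ∀ h s s', h ∈ H → s :: h ∈ H → s' ∈ G.nbrs (G.pos h) → s' :: h ∈ H

theorem mem_initHist {τ : ℕ} {h : List V} : h ∈ G.initHist τ ↔ ∃ t ≤ τ, h ∈ G.hist t := by
  simp [initHist]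

theorem isFullTree_initHist {τ : ℕ} (hτ : 0 < τ) : G.IsFullTree (G.initHist τ) where
  isHist h hh := by
    obtain ⟨t, -, ht⟩ := mem_initHist.1 hh
    exact ⟨t, ht⟩
  root := mem_initHist.2 ⟨0, hτ.le, mem_hist_zero.2 rfl⟩
  first s hs := mem_initHist.2 ⟨1, hτ, cons_mem_hist_succ.2 ⟨mem_hist_zero.2 rfl, hs⟩⟩
  tail h s hne hh := by
    obtain ⟨t, ht, hh⟩ := mem_initHist.1 hh
    cases t with
    | zero => exact absurd (List.cons.inj (mem_hist_zero.1 hh)).2 hne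
    | succ t => exact mem_initHist.2 ⟨t, by omega, (cons_mem_hist_succ.1 hh).1⟩
  full h s s' hh hc hs' := by
    obtain ⟨t, ht, hc⟩ := mem_initHist.1 hc
    obtain ⟨k, -, hk⟩ := mem_initHist.1 hh
    have h1 := length_of_mem_hist hc
    have h2 := length_of_mem_hist hk
    simp only [List.length_cons] at h1
    exact mem_initHist.2 ⟨k + 1, by omega, cons_mem_hist_succ.2 ⟨hk, hs'⟩⟩

theorem mem_reachedFrontier {H : Finset (List V)} {x : PrimalVars V ι} {h : List V} :
    h ∈ G.reachedFrontier H x ↔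
      h ∈ H ∧ ∃ θ, G.IsFrontier H θ h ∧ 0 < histProb (G.restrictedAct x θ) h * x.typ θ := by
  simp [reachedFrontier]

theorem cons_mem_expand {H : Finset (List V)} {x : PrimalVars V ι} {s : V} {h : List V} :
    s :: h ∈ G.expand H x ↔
      s :: h ∈ H ∨ (h ∈ G.reachedFrontier H x ∧ s ∈ G.nbrs (G.pos h)) := by
  simp only [expand, Finset.mem_union, Finset.mem_biUnion, children, Finset.mem_image]
  refine or_congr_right ⟨?_, ?_⟩
  · rintro ⟨k, hk, s', hs', e⟩
    obtain ⟨rfl, rfl⟩ := List.cons.inj e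
    exact ⟨hk, hs'⟩
  · rintro ⟨hk, hs⟩
    exact ⟨h, hk, s, hs, rfl⟩

theorem IsFullTree.expand {H : Finset (List V)} (hH : G.IsFullTree H) (x : PrimalVars V ι) :
    G.IsFullTree (G.expand H x) := by
  have sub : H ⊆ G.expand H x := Finset.subset_union_left
  have subF : G.reachedFrontier H x ⊆ H := fun _ hk => (mem_reachedFrontier.1 hk).1
  have isHist : ∀ h ∈ G.expand H x, G.IsHist h := by
    intro h hh
    cases h with
    | nil =>
      rcases Finset.mem_union.1 hh with hh | hh
      · exact hH.isHist _ hh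
      · simp [children] at hh
    | cons s h =>
      rcases cons_mem_expand.1 hh with hh | ⟨hh, hs⟩
      · exact hH.isHist _ hh
      · exact (hH.isHist _ (subF hh)).cons hs
  refine ⟨isHist, sub hH.root, fun s hs => sub (hH.first s hs), ?_, ?_⟩
  · intro h s hne hc
    rcases cons_mem_expand.1 hc with hc | ⟨hh, -⟩
    · exact sub (hH.tail h s hne hc)
    · exact sub (subF hh)
  · intro h s s' hh hc hs'
    rcases cons_mem_expand.1 hc with hc | ⟨hk, -⟩
    · exact sub (hH.full h s s' (hH.tail h s (isHist h hh).ne_nil hc) hc hs')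
    · exact cons_mem_expand.2 (Or.inr ⟨hk, hs'⟩)

theorem Run.isFullTree {τ : ℕ} (hτ : 0 < τ) {H : Finset (List V)} {x : PrimalVars V ι}
    (h : G.Run τ H x) : G.IsFullTree H ∧ G.PrimalOptimal H x := by
  induction h with
  | init x hx => exact ⟨isFullTree_initHist hτ, hx⟩
  | step H x x' _ _ hx' ih => exact ⟨ih.1.expand x, hx'⟩

/-- Every goal can be reached from every node that is reachable from the initial position. -/
def GoalsReachable (G : DPPGame V ι) : Prop :=
  ∀ s, Relation.ReflTransGen G.edge G.s0 s → ∀ θ, Relation.ReflTransGen G.edge s (G.goal θ)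

theorem GoalsReachable.actions_nonempty (hG : G.GoalsReachable) {h : List V} (hh : G.IsHist h)
    (θ : ι) : (G.actions θ (G.pos h)).Nonempty :=
  DPPGame.actions_nonempty (hG _ hh.reachable θ)

namespace IsFullTree

variable {H : Finset (List V)} {θ : ι} {h : List V}

theorem cons_mem (hH : G.IsFullTree H) (hh : h ∈ H) (hg : G.goal θ ∉ h)
    (hf : ¬ G.IsFrontier H θ h) {s : V} (hs : s ∈ G.nbrs (G.pos h)) : s :: h ∈ H := by
  have : ∃ s', s' :: h ∈ H := by
    by_contra hc
    push Not at hc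
    exact hf ⟨hh, hg, hc⟩
  obtain ⟨s', hs'⟩ := this
  exact hH.full h s' s hh hs' hs

theorem root_not_frontier (hH : G.IsFullTree H) (hG : G.GoalsReachable) :
    ¬ G.IsFrontier H θ [G.s0] := by
  rintro ⟨-, hg, hc⟩
  obtain ⟨s, hs⟩ := hG.actions_nonempty isHist_root θ
  rw [actions_of_notMem isHist_root hg] at hs
  exact hc s (hH.first s hs)

end IsFullTree

theorem not_isFinal_iff {H : Finset (List V)} {θ : ι} {h : List V} (hh : h ∈ H) :
    ¬ G.IsFinal H θ h ↔ G.goal θ ∉ h ∧ ¬ G.IsFrontier H θ h := by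
  simp [IsFinal, hh]

/-- The part of the stage matrix that does not depend on the action of the Defender. -/
noncomputable def bonus (G : DPPGame V ι) (H : Finset (List V)) (θ : ι) (h : List V) (s : V) : ℝ :=
  if G.IsFrontier H θ h then (G.mdpValue θ s).toReal else if h = [G.s0] then G.r θ else 0

theorem stageMatrix_of_mem {H : Finset (List V)} {θ : ι} {h : List V} (hg : G.goal θ ∈ h) (a : ι)
    (s : V) : G.stageMatrix H θ h a s = 0 := by simp [stageMatrix, hg]

theorem stageMatrix_of_notMem {H : Finset (List V)} {θ : ι} {h : List V} (hg : G.goal θ ∉ h)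
    (a : ι) (s : V) :
    G.stageMatrix H θ h a s = G.stageCost θ (G.pos h) s a + G.bonus H θ h s := by
  rw [stageMatrix, bonus, if_neg hg]
  split_ifs <;> simp

theorem bonus_nonneg {H : Finset (List V)} {θ : ι} {h : List V} {s : V} :
    0 ≤ G.bonus H θ h s := by
  unfold bonus
  split_ifs
  · exact ENNReal.toReal_nonneg
  · exact G.r_nonneg θ
  · exact le_rfl

theorem stageMatrix_nonneg {H : Finset (List V)} {θ : ι} {h : List V} (hh : G.IsHist h) {s : V}
    (hs : s ∈ G.actions θ (G.pos h)) (a : ι) : 0 ≤ G.stageMatrix H θ h a s := by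
  by_cases hg : G.goal θ ∈ h
  · rw [stageMatrix_of_mem hg]
  · rw [stageMatrix_of_notMem hg]
    rw [actions_of_notMem hh hg] at hs
    exact add_nonneg (stageCost_nonneg hs a) bonus_nonneg

theorem sum_stageMatrix_mul {H : Finset (List V)} {θ : ι} {h : List V} (hg : G.goal θ ∉ h)
    {π : DefenderStrategy V ι} (hπ : π h ∈ stdSimplex ℝ ι) (s : V) :
    ∑ a, G.stageMatrix H θ h a s * π h a = G.meanStage θ π h s + G.bonus H θ h s := by
  simp only [stageMatrix_of_notMem hg, add_mul, Finset.sum_add_distrib, ← Finset.mul_sum, hπ.2,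
    mul_one, meanStage]
  congr 1
  exact Finset.sum_congr rfl fun a _ => mul_comm _ _

/-! ### Default strategies -/

theorem walkCost_ne_top (c : V → V → ℝ) (s : V) (l : List V) : walkCost c s l ≠ ∞ := by
  induction l generalizing s with
  | nil => simp [walkCost]
  | cons t l ih => simp [walkCost, ih t]

theorem mdpValue_goal (θ : ι) : G.mdpValue θ (G.goal θ) = 0 := by
  refine le_antisymm (iInf₂_le_of_le [] ⟨by simp, by simp⟩ ?_) bot_le
  simp [walkCost]

theorem mdpValue_ne_top {θ : ι} {s : V} (hs : Relation.ReflTransGen G.edge s (G.goal θ)) :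
    G.mdpValue θ s ≠ ∞ := by
  obtain ⟨l, hl, e⟩ := List.exists_isChain_cons_of_relationReflTransGen hs
  have : G.mdpValue θ s ≤ walkCost (G.mdpCost θ) s l :=
    iInf₂_le l ⟨hl, by rw [List.getLast?_eq_some_getLast (List.cons_ne_nil _ _), e]⟩
  exact ne_top_of_le_ne_top (walkCost_ne_top _ _ _) this

theorem mdpValue_le {θ : ι} {s s' : V} (hs : G.edge s s') :
    G.mdpValue θ s ≤ ENNReal.ofReal (G.mdpCost θ s s') + G.mdpValue θ s' := by
  conv_rhs => rw [mdpValue, dist, ENNReal.add_iInf]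
  refine le_iInf fun l => ?_
  by_cases hl : List.IsChain G.edge (s' :: l) ∧ (s' :: l).getLast? = some (G.goal θ)
  · rw [iInf_pos hl]
    refine iInf₂_le_of_le (s' :: l) ⟨List.isChain_cons_cons.2 ⟨hs, hl.1⟩, ?_⟩ le_rfl
    rw [List.getLast?_cons_cons, hl.2]
  · rw [iInf_neg hl]
    simp

theorem mdpCost_nonneg {θ : ι} {s s' : V} (hs : s' ∈ G.nbrs s) : 0 ≤ G.mdpCost θ s s' := by
  refine Finset.sum_nonneg fun a _ => mul_nonneg ?_ (stageCost_nonneg hs a)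
  unfold defaultDefender
  split_ifs <;> norm_num

theorem GoalsReachable.toReal_mdpValue_le (hG : G.GoalsReachable) {h : List V} (hh : G.IsHist h)
    (θ : ι) {s : V} (hs : s ∈ G.nbrs (G.pos h)) :
    (G.mdpValue θ (G.pos h)).toReal ≤
      G.mdpCost θ (G.pos h) s + (G.mdpValue θ s).toReal := by
  have hs' : G.mdpValue θ s ≠ ∞ := mdpValue_ne_top (hG _ (hh.cons hs).reachable θ)
  have := ENNReal.toReal_mono (by finiteness) (mdpValue_le (θ := θ) (mem_nbrs.1 hs))
  rwa [ENNReal.toReal_add (by finiteness) hs', ENNReal.toReal_ofReal (mdpCost_nonneg hs)] at this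

theorem meanStage_defaultDefender {θ : ι} {π : DefenderStrategy V ι} {h : List V} {s : V}
    (hπ : π h = G.defaultDefender h) : G.meanStage θ π h s = G.mdpCost θ (G.pos h) s := by
  rw [meanStage, hπ]; rfl

theorem defaultDefender_mem_stdSimplex (h : List V) : G.defaultDefender h ∈ stdSimplex ℝ ι := by
  refine ⟨fun a => ?_, ?_⟩
  · unfold defaultDefender
    split_ifs <;> norm_num
  · simp [defaultDefender]

/-! ### A lower bound on the cost of the Attacker -/

/-- The cost of type `θ` that is accumulated up to time `N + 1`. -/
noncomputable def cutCost (G : DPPGame V ι) (θ : ι) (π : DefenderStrategy V ι) (N : ℕ) :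
    List V → ℝ
  | [] => 0
  | s :: h => if h.length ≤ N + 1 then G.meanCost θ π (s :: h) else cutCost G θ π N h

theorem cutCost_of_length_le {θ : ι} {π : DefenderStrategy V ι} {N : ℕ} {h : List V}
    (hh : h.length ≤ N + 2) : G.cutCost θ π N h = G.meanCost θ π h := by
  cases h with
  | nil => rfl
  | cons s h =>
    simp only [List.length_cons] at hh
    rw [cutCost, if_pos (by omega)]

theorem cutCost_cons_of_lt {θ : ι} {π : DefenderStrategy V ι} {N : ℕ} {h : List V} {s : V}
    (hh : N + 1 < h.length) : G.cutCost θ π N (s :: h) = G.cutCost θ π N h := by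
  rw [cutCost, if_neg (by omega)]

theorem cutCost_le_meanCost {θ : ι} {π : DefenderStrategy V ι} (hπ : G.IsDefenderStrategy π) (N : ℕ)
    {h : List V} (hh : G.IsHist h) : G.cutCost θ π N h ≤ G.meanCost θ π h := by
  induction hh using IsHist.induction with
  | root => rw [cutCost_of_length_le (by simp)]
  | step h s hh hs ih =>
    by_cases hl : h.length ≤ N + 1
    · rw [cutCost_of_length_le (by simpa using hl)]
    · rw [cutCost_cons_of_lt (by omega), meanCost_cons θ π hh.ne_nil]
      linarith [meanStage_nonneg (θ := θ) hπ hh hs]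

theorem exists_cutCost_le {θ : ι} {π : DefenderStrategy V ι} (N : ℕ) :
    ∃ C, ∀ h, G.IsHist h → G.cutCost θ π N h ≤ C := by
  refine ⟨∑ k ∈ G.initHist (N + 1), |G.meanCost θ π k|, fun h hh => ?_⟩
  have main : ∀ h ∈ G.initHist (N + 1),
      G.meanCost θ π h ≤ ∑ k ∈ G.initHist (N + 1), |G.meanCost θ π k| := fun h hm =>
    (le_abs_self _).trans (Finset.single_le_sum (f := fun k => |G.meanCost θ π k|)
      (fun k _ => abs_nonneg _) hm)
  induction hh using IsHist.induction with
  | root =>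
    rw [cutCost_of_length_le (by simp)]
    exact main _ (mem_initHist.2 ⟨0, by omega, mem_hist_zero.2 rfl⟩)
  | step h s hh hs ih =>
    by_cases hl : h.length ≤ N + 1
    · rw [cutCost_of_length_le (by simpa using hl)]
      obtain ⟨n, hn⟩ := hh
      have := length_of_mem_hist hn
      exact main _ (mem_initHist.2 ⟨n + 1, by omega, cons_mem_hist_succ.2 ⟨hn, hs⟩⟩)
    · rwa [cutCost_cons_of_lt (by omega)]

theorem IsPolicy.stopSum_mono {θ : ι} {g : List V → V → ℝ} (hg : G.IsPolicy θ g) (N : ℕ)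
    {F F' : List V → ℝ} (h : ∀ n ≤ N, ∀ h ∈ G.hist n, F h ≤ F' h) :
    G.stopSum θ g N F ≤ G.stopSum θ g N F' := by
  refine add_le_add (Finset.sum_le_sum fun n hn => Finset.sum_le_sum fun k hk => ?_)
    (Finset.sum_le_sum fun k hk => ?_)
  · have hk' := (mem_hits.1 hk).1
    exact mul_le_mul_of_nonneg_left (h n (Nat.lt_succ_iff.1 (Finset.mem_range.1 hn)) k hk')
      (hg.histProb_nonneg ⟨n, hk'⟩)
  · have hk' := (mem_alive.1 hk).1
    exact mul_le_mul_of_nonneg_left (h N le_rfl k hk') (hg.histProb_nonneg ⟨N, hk'⟩)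

/-- Against a policy that reaches the goal almost surely, a bound on all costs up to the goal is
also a bound on the costs up to the time `N`, including the plays that are still running then:
those costs are kept when a play goes on to its goal, and they are bounded for fixed `N`. -/
theorem IsPolicy.stopSum_meanCost_le {θ : ι} {g : List V → V → ℝ} (hg : G.IsPolicy θ g)
    (hit : G.hitProb θ g = 1) {π : DefenderStrategy V ι} (hπ : G.IsDefenderStrategy π) {B : ℝ}
    (hB : ∀ M, ∑ n ∈ Finset.range (M + 1), ∑ h ∈ G.hits θ n, histProb g h * G.meanCost θ π h ≤ B)
    (N : ℕ) : G.stopSum θ g N (G.meanCost θ π) ≤ B := by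
  obtain ⟨C, hC⟩ := exists_cutCost_le (G := G) (θ := θ) (π := π) N
  have const : ∀ k, G.stopSum θ g (N + 1 + k) (G.cutCost θ π N) =
      G.stopSum θ g (N + 1) (G.cutCost θ π N) := by
    intro k
    induction k with
    | zero => rfl
    | succ k ih =>
      rw [← add_assoc, stopSum_succ, ih, add_eq_left]
      refine Finset.sum_eq_zero fun h hh => ?_
      obtain ⟨h1, h2⟩ := mem_alive.1 hh
      have hl := length_of_mem_hist h1
      have : ∀ s ∈ G.nbrs (G.pos h), g h s * G.cutCost θ π N (s :: h) =
          g h s * G.cutCost θ π N h := fun s _ => by rw [cutCost_cons_of_lt (by omega)]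
      rw [Finset.sum_congr rfl this, ← Finset.sum_mul, hg.sum_nbrs ⟨_, h1⟩ h2]
      simp
  have first : G.stopSum θ g N (G.meanCost θ π) ≤
      G.stopSum θ g (N + 1) (G.cutCost θ π N) := by
    have e : G.stopSum θ g (N + 1) (G.cutCost θ π N) =
        G.stopSum θ g (N + 1) (G.meanCost θ π) := by
      refine le_antisymm (hg.stopSum_mono _ fun n hn h hh => ?_)
        (hg.stopSum_mono _ fun n hn h hh => ?_) <;>
      · have := length_of_mem_hist hh
        rw [cutCost_of_length_le (by omega)]
    rw [e, stopSum_succ, le_add_iff_nonneg_right]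
    refine Finset.sum_nonneg fun h hh => ?_
    obtain ⟨h1, h2⟩ := mem_alive.1 hh
    have hh' : G.IsHist h := ⟨_, h1⟩
    refine mul_nonneg (hg.histProb_nonneg hh') ?_
    calc (0 : ℝ) = ∑ s ∈ G.nbrs (G.pos h), g h s * G.meanCost θ π h - G.meanCost θ π h := by
          rw [← Finset.sum_mul, hg.sum_nbrs hh' h2, one_mul, sub_self]
      _ ≤ _ := by
          refine sub_le_sub_right (Finset.sum_le_sum fun s hs => ?_) _
          rw [meanCost_cons θ π hh'.ne_nil]
          exact mul_le_mul_of_nonneg_left (by linarith [meanStage_nonneg (θ := θ) hπ hh' hs])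
            (hg.nonneg hh' s)
  have bound : ∀ k, G.stopSum θ g N (G.meanCost θ π) ≤ B + C * G.aliveProb θ g (N + 1 + k) := by
    intro k
    refine (first.trans_eq (const k).symm).trans (add_le_add (le_trans ?_ (hB (N + 1 + k))) ?_)
    · refine Finset.sum_le_sum fun n _ => Finset.sum_le_sum fun h hh => ?_
      have hh' : G.IsHist h := ⟨n, (mem_hits.1 hh).1⟩
      exact mul_le_mul_of_nonneg_left (cutCost_le_meanCost hπ N hh') (hg.histProb_nonneg hh')
    · rw [aliveProb, Finset.mul_sum]
      refine Finset.sum_le_sum fun h hh => ?_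
      have hh' : G.IsHist h := ⟨_, (mem_alive.1 hh).1⟩
      rw [mul_comm C]
      exact mul_le_mul_of_nonneg_left (hC h hh') (hg.histProb_nonneg hh')
  have lim : Filter.Tendsto (fun k => B + C * G.aliveProb θ g (N + 1 + k)) Filter.atTop
      (nhds (B + C * 0)) := by
    refine Filter.Tendsto.const_add B (Filter.Tendsto.const_mul C ?_)
    have := hg.hitProb_eq_one_iff.1 hit
    exact (this.comp (Filter.tendsto_add_atTop_nat (N + 1))).congr fun k => by
      rw [Function.comp_apply, add_comm]
  simpa using ge_of_tendsto' lim bound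

/-- Dynamic programming lower bound: a bounded function `Q` of the history that vanishes at the goal
and nowhere exceeds the expected stage cost plus its value after the move is a lower bound on the
expected cost of every policy that reaches the goal almost surely. -/
theorem IsPolicy.le_of_submartingale {θ : ι} {g : List V → V → ℝ} (hg : G.IsPolicy θ g)
    (hit : G.hitProb θ g = 1) {π : DefenderStrategy V ι} (hπ : G.IsDefenderStrategy π)
    {Q : List V → ℝ} {K : ℝ} (hK : ∀ h, G.IsHist h → Q h ≤ K)
    (hgoal : ∀ h, G.goal θ ∈ h → Q h = 0)
    (hQ : ∀ h, G.IsHist h → G.goal θ ∉ h → ∀ s ∈ G.nbrs (G.pos h),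
      Q h ≤ G.meanStage θ π h s + Q (s :: h)) {B : ℝ}
    (hB : ∀ M, ∑ n ∈ Finset.range (M + 1), ∑ h ∈ G.hits θ n, histProb g h * G.meanCost θ π h ≤ B) :
    Q [G.s0] ≤ B := by
  have sub : ∀ N, Q [G.s0] ≤ G.stopSum θ g N (fun h => G.meanCost θ π h + Q h) := by
    intro N
    induction N with
    | zero => simp [stopSum_zero, meanCost]
    | succ N ih =>
      rw [stopSum_succ]
      refine ih.trans (le_add_of_nonneg_right (Finset.sum_nonneg fun h hh => ?_))
      obtain ⟨h1, h2⟩ := mem_alive.1 hh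
      have hh' : G.IsHist h := ⟨_, h1⟩
      refine mul_nonneg (hg.histProb_nonneg hh') ?_
      calc (0 : ℝ) = ∑ s ∈ G.nbrs (G.pos h), g h s * (G.meanCost θ π h + Q h) -
              (G.meanCost θ π h + Q h) := by
            rw [← Finset.sum_mul, hg.sum_nbrs hh' h2, one_mul, sub_self]
        _ ≤ _ := by
            refine sub_le_sub_right (Finset.sum_le_sum fun s hs => ?_) _
            rw [meanCost_cons θ π hh'.ne_nil]
            exact mul_le_mul_of_nonneg_left (by linarith [hQ h hh' h2 s hs]) (hg.nonneg hh' s)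
  have bound : ∀ N, Q [G.s0] ≤ B + K * G.aliveProb θ g N := by
    intro N
    refine (sub N).trans ?_
    rw [stopSum_add]
    refine add_le_add (hg.stopSum_meanCost_le hit hπ hB N) ?_
    have hz : ∀ n, ∑ h ∈ G.hits θ n, histProb g h * Q h = 0 := fun n =>
      Finset.sum_eq_zero fun h hh => by
        obtain ⟨-, -, k, rfl, -⟩ := mem_hits.1 hh
        rw [hgoal _ (by simp), mul_zero]
    rw [stopSum, Finset.sum_eq_zero fun n _ => hz n, zero_add, aliveProb, Finset.mul_sum]
    refine Finset.sum_le_sum fun h hh => ?_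
    have hh' : G.IsHist h := ⟨_, (mem_alive.1 hh).1⟩
    rw [mul_comm K]
    exact mul_le_mul_of_nonneg_left (hK h hh') (hg.histProb_nonneg hh')
  have lim := (hg.hitProb_eq_one_iff.1 hit).const_mul K |>.const_add B
  simpa using ge_of_tendsto' lim bound

theorem finalDefender_isDefenderStrategy {H : Finset (List V)} {y : DualVars V ι}
    (hy : G.DualFeasible H y) : G.IsDefenderStrategy (G.finalDefender H y) := by
  intro h _
  unfold finalDefender
  split_ifs with hh
  · exact hy.1 h hh
  · exact defaultDefender_mem_stdSimplex h

/-- The value of a feasible solution of the Defender's program is guaranteed in the original game: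
outside `H`, the default strategy secures the values `V^θ` used at the frontier. -/
theorem DualFeasible.le_typeCost (hG : G.GoalsReachable) {H : Finset (List V)}
    (hH : G.IsFullTree H) {y : DualVars V ι} (hy : G.DualFeasible H y) {θ : ι}
    {g : List V → V → ℝ} (hg : G.IsPolicy θ g) (hit : G.hitProb θ g = 1) :
    ENNReal.ofReal y.U ≤ G.typeCost θ (G.finalDefender H y) g := by
  have hπ := finalDefender_isDefenderStrategy hy
  have terminal : ∀ h ∈ H, G.goal θ ∈ h → y.q θ h ≤ 0 := by
    intro h hh hg
    obtain ⟨s, hs⟩ := hG.actions_nonempty (hH.isHist h hh) θ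
    simpa [stageMatrix_of_mem hg] using hy.2.2.2 θ h ⟨hh, Or.inl hg⟩ s hs
  by_cases hs0 : G.goal θ = G.s0
  · have : y.U ≤ 0 := (hy.2.1 θ).trans (terminal _ hH.root (by simp [hs0]))
    simp [ENNReal.ofReal_of_nonpos this]
  rw [typeCost_eq hπ hg]
  generalize hT : ∑' n, ENNReal.ofReal (∑ h ∈ G.hits θ n, histProb g h *
    G.meanCost θ (G.finalDefender H y) h) = T
  by_cases hTtop : T = ∞
  · simp [hTtop]
  have hB : ∀ M, ∑ n ∈ Finset.range (M + 1), ∑ h ∈ G.hits θ n, histProb g h *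
      G.meanCost θ (G.finalDefender H y) h ≤ T.toReal := by
    intro M
    have hnn : ∀ n ∈ Finset.range (M + 1), 0 ≤ ∑ h ∈ G.hits θ n, histProb g h *
        G.meanCost θ (G.finalDefender H y) h := fun n _ => Finset.sum_nonneg fun h hh =>
      mul_nonneg (hg.histProb_nonneg ⟨n, (mem_hits.1 hh).1⟩)
        (meanCost_nonneg hπ ⟨n, (mem_hits.1 hh).1⟩)
    rw [← ENNReal.ofReal_le_iff_le_toReal hTtop, ENNReal.ofReal_sum_of_nonneg hnn, ← hT]
    exact ENNReal.sum_le_tsum _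
  -- the stage matrix at the root includes `r θ`, which is not a stage cost of the original game
  set Q : List V → ℝ := fun h => if G.goal θ ∈ h then 0 else
    (if h ∈ H then y.q θ h else (G.mdpValue θ (G.pos h)).toReal) -
      if h = [G.s0] then G.r θ else 0 with hQdef
  have hQ0 : Q [G.s0] = y.q θ [G.s0] - G.r θ := by
    simp [hQdef, hs0, hH.root]
  have key : Q [G.s0] ≤ T.toReal := by
    refine hg.le_of_submartingale hit hπ (Q := Q)
      (K := ∑ h ∈ H, |y.q θ h| + ∑ s, (G.mdpValue θ s).toReal) ?_ ?_ ?_ hB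
    · intro h _
      have h1 : 0 ≤ ∑ h ∈ H, |y.q θ h| := Finset.sum_nonneg fun _ _ => abs_nonneg _
      have h2 : 0 ≤ ∑ s, (G.mdpValue θ s).toReal :=
        Finset.sum_nonneg fun _ _ => ENNReal.toReal_nonneg
      have h3 : 0 ≤ if h = [G.s0] then G.r θ else 0 := by
        split_ifs
        · exact G.r_nonneg θ
        · exact le_rfl
      have h4 : (G.mdpValue θ (G.pos h)).toReal ≤ ∑ s, (G.mdpValue θ s).toReal :=
        Finset.single_le_sum (f := fun s => (G.mdpValue θ s).toReal)
          (fun _ _ => ENNReal.toReal_nonneg) (Finset.mem_univ _)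
      simp only [hQdef]
      by_cases hg : G.goal θ ∈ h
      · rw [if_pos hg]; linarith
      rw [if_neg hg]
      by_cases hh : h ∈ H
      · rw [if_pos hh]
        have := Finset.single_le_sum (f := fun h => |y.q θ h|) (fun _ _ => abs_nonneg _) hh
        linarith [le_abs_self (y.q θ h)]
      · rw [if_neg hh]; linarith
    · intro h hg
      simp [hQdef, hg]
    · intro h hh hgh s hs
      have hs1 : s :: h ≠ [G.s0] := fun e => hh.ne_nil (List.cons.inj e).2
      have act : s ∈ G.actions θ (G.pos h) := by rwa [actions_of_notMem hh hgh]
      have child : s :: h ∉ H → Q (s :: h) = (G.mdpValue θ s).toReal := by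
        intro hc
        simp only [hQdef, hc, if_false, if_neg hs1, pos_cons, sub_zero]
        split_ifs with hg
        · have : s = G.goal θ := by
            rcases List.mem_cons.1 hg with e | e
            · exact e.symm
            · exact absurd e hgh
          rw [this, mdpValue_goal, ENNReal.toReal_zero]
        · rfl
      by_cases hm : h ∈ H
      · have hfin := hπ h hh
        have sm := sum_stageMatrix_mul (H := H) hgh hfin s
        have epol : G.finalDefender H y h = y.pol h := by simp [finalDefender, hm]
        by_cases hf : G.IsFrontier H θ h
        · have hne : h ≠ [G.s0] := by
            rintro rfl
            exact hH.root_not_frontier hG hf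
          have := hy.2.2.2 θ h ⟨hm, Or.inr hf⟩ s act
          rw [← epol, sm, bonus, if_pos hf] at this
          rw [child (hf.2.2 s)]
          simpa [hQdef, hgh, hm, hne] using this
        · have hc := hH.cons_mem hm hgh hf hs
          have := hy.2.2.1 θ h hm ((not_isFinal_iff hm).2 ⟨hgh, hf⟩) s act
          rw [← epol, sm, bonus, if_neg hf] at this
          have hQc : y.q θ (s :: h) ≤ Q (s :: h) := by
            simp only [hQdef, hc, if_true, if_neg hs1, sub_zero]
            split_ifs with hg
            · exact terminal _ hc hg
            · exact le_rfl
          simp only [hQdef, if_neg hgh, if_pos hm] at hQc ⊢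
          linarith
      · have hc : s :: h ∉ H := fun hc => hm (hH.tail h s hh.ne_nil hc)
        have hne : h ≠ [G.s0] := by
          rintro rfl
          exact hm hH.root
        rw [child hc, meanStage_defaultDefender (by simp [finalDefender, hm])]
        simpa [hQdef, hgh, hm, hne] using hG.toReal_mdpValue_le hh θ hs
  rw [← ENNReal.ofReal_toReal hTtop, ← ENNReal.ofReal_add ENNReal.toReal_nonneg (G.r_nonneg θ)]
  refine ENNReal.ofReal_le_ofReal ?_
  linarith [hy.2.1 θ]

theorem DualFeasible.le_cost (hG : G.GoalsReachable) {H : Finset (List V)}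
    (hH : G.IsFullTree H) {y : DualVars V ι} (hy : G.DualFeasible H y)
    {γ : AttackerStrategy V ι} (hγ : G.IsAttackerStrategy γ) :
    ENNReal.ofReal y.U ≤ G.cost (G.finalDefender H y) γ := by
  calc ENNReal.ofReal y.U = ∑ θ, ENNReal.ofReal (γ.typ θ) * ENNReal.ofReal y.U := by
        rw [← Finset.sum_mul, ← ENNReal.ofReal_sum_of_nonneg fun θ _ => hγ.1.1 θ, hγ.1.2]
        simp
    _ ≤ _ := Finset.sum_le_sum fun θ _ =>
        mul_le_mul_right (hy.le_typeCost hG hH (hγ.2.1 θ) (hγ.2.2 θ)) _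

/-! ### The strategy of the Attacker -/

theorem restrictedAct_mem_stdSimplex (hG : G.GoalsReachable) {x : PrimalVars V ι} {θ : ι}
    {h : List V} (hh : G.IsHist h) (hz : ∀ s, 0 ≤ x.z θ h s) :
    G.restrictedAct x θ h ∈ stdSimplex ℝ V := by
  refine ⟨fun s => ?_, ?_⟩
  · unfold restrictedAct
    split_ifs with h1 h2
    · exact div_nonneg (hz s) h2.le
    · positivity
    · exact le_rfl
  · simp only [restrictedAct]
    rw [Finset.sum_ite_mem, Finset.univ_inter]
    split_ifs with h2
    · rw [← Finset.sum_div, div_self h2.ne']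
    · have := (hG.actions_nonempty hh θ).card_pos
      rw [Finset.sum_const, nsmul_eq_mul]
      field_simp

theorem iterate_of_isChain {f : V → V} {g s : V} {l : List V}
    (hl : List.IsChain (fun x y => x ≠ g ∧ y = f x) (s :: l))
    (hg : (s :: l).getLast? = some g) : f^[l.length] s = g := by
  induction l generalizing s with
  | nil => simpa using hg
  | cons t l ih =>
    rw [List.isChain_cons_cons] at hl
    rw [List.getLast?_cons_cons] at hg
    rw [List.length_cons, Function.iterate_succ_apply, ← hl.1.2]
    exact ih hl.2 hg

theorem finalAttacker_isPolicy (hG : G.GoalsReachable) {σ : ι → V → V}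
    (hσ : G.IsDefaultAttacker σ) {H : Finset (List V)} {x : PrimalVars V ι}
    (hx : G.PrimalFeasible H x) (θ : ι) : G.IsPolicy θ ((G.finalAttacker H x σ).act θ) := by
  intro h hh
  by_cases hm : h ∈ H
  · have e : (G.finalAttacker H x σ).act θ h = G.restrictedAct x θ h := by
      funext s; simp [finalAttacker, hm]
    rw [e]
    exact ⟨restrictedAct_mem_stdSimplex hG hh (hx.2.2.1 θ h hm), fun s hs => if_neg hs⟩
  · have e : (G.finalAttacker H x σ).act θ h = fun s => if s = σ θ (G.pos h) then 1 else 0 := by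
      funext s; simp [finalAttacker, hm]
    rw [e]
    refine ⟨⟨fun s => ?_, by simp⟩, fun s hs => if_neg ?_⟩
    · dsimp only
      split_ifs <;> norm_num
    · rintro rfl
      exact hs (hσ θ _ (mdpValue_ne_top (hG _ hh.reachable θ))).1

/-- Outside the finite set `H`, the Attacker follows a stationary policy that leads to the goal in
a bounded number of steps. -/
theorem finalAttacker_hitProb (hG : G.GoalsReachable) {σ : ι → V → V}
    (hσ : G.IsDefaultAttacker σ) {H : Finset (List V)} {x : PrimalVars V ι}
    (hx : G.PrimalFeasible H x) (θ : ι) :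
    G.hitProb θ ((G.finalAttacker H x σ).act θ) = 1 := by
  have hg := finalAttacker_isPolicy hG hσ hx θ
  rw [hg.hitProb_eq_one_iff]
  have hit : ∀ s, ∃ i, Relation.ReflTransGen G.edge G.s0 s → (σ θ)^[i] s = G.goal θ := by
    intro s
    by_cases hs : Relation.ReflTransGen G.edge G.s0 s
    · obtain ⟨-, l, h1, h2, -⟩ := hσ θ s (mdpValue_ne_top (hG s hs θ))
      exact ⟨l.length, fun _ => iterate_of_isChain h1 h2⟩
    · exact ⟨0, fun h => absurd h hs⟩
  choose d hd using hit
  set D := Finset.univ.sup d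
  set L := H.sup List.length
  have claim : ∀ k, ∀ h ∈ G.alive θ (L + k), histProb ((G.finalAttacker H x σ).act θ) h ≠ 0 →
      ∃ i, i + k ≤ D ∧ (σ θ)^[i] (G.pos h) = G.goal θ := by
    intro k
    induction k with
    | zero =>
      intro h hh _
      exact ⟨d (G.pos h), Finset.le_sup (f := d) (Finset.mem_univ _),
        hd _ (IsHist.reachable ⟨_, (mem_alive.1 hh).1⟩)⟩
    | succ k ih =>
      intro h hh hp
      obtain ⟨h1, h2⟩ := mem_alive.1 hh
      replace h1 : h ∈ G.hist (L + k + 1) := h1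
      obtain ⟨h', hh', s, hs, rfl⟩ := mem_hist_succ.1 h1
      rw [List.mem_cons, not_or] at h2
      have hl := length_of_mem_hist hh'
      have hI : G.IsHist h' := ⟨_, hh'⟩
      have hm : h' ∉ H := fun hm => by
        have : h'.length ≤ L := Finset.le_sup (f := List.length) hm
        omega
      rw [histProb_cons _ hI.ne_nil] at hp
      have hsσ : s = σ θ (G.pos h') := by
        by_contra hne
        exact hp (by simp [finalAttacker, hm, hne])
      obtain ⟨i, hi, hit⟩ := ih h' (mem_alive.2 ⟨hh', h2.2⟩) (left_ne_zero_of_mul hp)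
      cases i with
      | zero => exact absurd (hit ▸ hI.pos_mem) h2.2
      | succ j =>
        refine ⟨j, by omega, ?_⟩
        rw [pos_cons, hsσ, ← Function.iterate_succ_apply, hit]
  refine tendsto_const_nhds.congr' ?_
  filter_upwards [Filter.eventually_ge_atTop (L + (D + 1))] with n hn
  obtain ⟨k, rfl⟩ := Nat.exists_eq_add_of_le (show L ≤ n by omega)
  symm
  refine Finset.sum_eq_zero fun h hh => ?_
  by_contra hp
  obtain ⟨i, hi, -⟩ := claim k h hh hp
  omega

theorem finalAttacker_isAttackerStrategy (hG : G.GoalsReachable) {σ : ι → V → V}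
    (hσ : G.IsDefaultAttacker σ) {H : Finset (List V)} {x : PrimalVars V ι}
    (hx : G.PrimalFeasible H x) : G.IsAttackerStrategy (G.finalAttacker H x σ) :=
  ⟨hx.1, fun θ => finalAttacker_isPolicy hG hσ hx θ, fun θ => finalAttacker_hitProb hG hσ hx θ⟩

/-! ### An upper bound on the cost of the Attacker -/

theorem restrictedAct_mul_sum {x : PrimalVars V ι} {θ : ι} {h : List V} (hz : ∀ s, 0 ≤ x.z θ h s)
    (hz0 : ∀ s, s ∉ G.actions θ (G.pos h) → x.z θ h s = 0) (s : V) :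
    G.restrictedAct x θ h s * ∑ t ∈ G.actions θ (G.pos h), x.z θ h t = x.z θ h s := by
  unfold restrictedAct
  split_ifs with h1 h2
  · rw [div_mul_cancel₀ _ h2.ne']
  · have h3 : ∑ t ∈ G.actions θ (G.pos h), x.z θ h t = 0 :=
      le_antisymm (not_lt.1 h2) (Finset.sum_nonneg fun t _ => hz t)
    rw [h3, mul_zero, (Finset.sum_eq_zero_iff_of_nonneg fun t _ => hz t).1 h3 s h1]
  · rw [zero_mul, hz0 s h1]

theorem finalAttacker_act_of_mem {H : Finset (List V)} {x : PrimalVars V ι} {σ : ι → V → V} (θ : ι)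
    {h : List V} (hh : h ∈ H) : (G.finalAttacker H x σ).act θ h = G.restrictedAct x θ h := by
  funext s; simp [finalAttacker, hh]

theorem IsFullTree.histProb_finalAttacker {H : Finset (List V)} (hH : G.IsFullTree H)
    {x : PrimalVars V ι} {σ : ι → V → V} (θ : ι) {h : List V} (hh : h ∈ H) :
    histProb ((G.finalAttacker H x σ).act θ) h = histProb (G.restrictedAct x θ) h := by
  have hI := hH.isHist h hh
  induction hI using IsHist.induction with
  | root => rfl
  | step h s hI hs ih =>
    have hm := hH.tail h s hI.ne_nil hh
    rw [histProb_cons _ hI.ne_nil, histProb_cons _ hI.ne_nil, ih hm, finalAttacker_act_of_mem θ hm]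

/-- The variables of the Attacker's program are the realization probabilities of the extracted
strategy. -/
theorem PrimalFeasible.histProb_mul_typ {H : Finset (List V)} (hH : G.IsFullTree H)
    {x : PrimalVars V ι} (hx : G.PrimalFeasible H x) (θ : ι) {h : List V} (hh : h ∈ H) :
    histProb (G.restrictedAct x θ) h * x.typ θ = ∑ s ∈ G.actions θ (G.pos h), x.z θ h s := by
  have hI := hH.isHist h hh
  induction hI using IsHist.induction with
  | root => simpa [histProb] using (hx.2.1 θ).symm
  | step h s hI hs ih =>
    have hm := hH.tail h s hI.ne_nil hh
    rw [histProb_cons _ hI.ne_nil, mul_right_comm, ih hm, mul_comm,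
      restrictedAct_mul_sum (hx.2.2.1 θ h hm) (hx.2.2.2.1 θ h hm), pos_cons,
      hx.2.2.2.2.2 θ h hm s hh]

/-- If no frontier history is reached, then no selected type leaves `H` before it reaches its
goal. -/
theorem PrimalFeasible.typ_mul_histProb_eq_zero {H : Finset (List V)} (hH : G.IsFullTree H)
    {x : PrimalVars V ι} (hx : G.PrimalFeasible H x) (hunreached : G.reachedFrontier H x = ∅)
    (σ : ι → V → V) (θ : ι) {h : List V} (hI : G.IsHist h) (hg : G.goal θ ∉ h) (hh : h ∉ H) :
    x.typ θ * histProb ((G.finalAttacker H x σ).act θ) h = 0 := by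
  induction hI using IsHist.induction with
  | root => exact absurd hH.root hh
  | step h s hI hs ih =>
    rw [List.mem_cons, not_or] at hg
    rw [histProb_cons _ hI.ne_nil, ← mul_assoc]
    by_cases hm : h ∈ H
    · have hf : G.IsFrontier H θ h := by
        by_contra hf
        exact hh (hH.cons_mem hm hg.2 hf hs)
      have hle : histProb (G.restrictedAct x θ) h * x.typ θ ≤ 0 := by
        by_contra hc
        have : h ∈ G.reachedFrontier H x := mem_reachedFrontier.2 ⟨hm, θ, hf, not_le.1 hc⟩
        rw [hunreached] at this
        simp at this
      have hge : 0 ≤ histProb (G.restrictedAct x θ) h * x.typ θ := by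
        rw [hx.histProb_mul_typ hH θ hm]
        exact Finset.sum_nonneg fun s _ => hx.2.2.1 θ h hm s
      rw [hH.histProb_finalAttacker θ hm, mul_comm (x.typ θ), le_antisymm hle hge, zero_mul]
    · rw [ih hg.2 hm, zero_mul]

/-- Total contribution of type `θ` to the payoff of the restricted game. -/
noncomputable def restrictedPayoff (G : DPPGame V ι) (H : Finset (List V))
    (π : DefenderStrategy V ι) (z : ι → List V → V → ℝ) (θ : ι) : ℝ :=
  ∑ h ∈ H, ∑ a, π h a * ∑ s ∈ G.actions θ (G.pos h), G.stageMatrix H θ h a s * z θ h s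

theorem typ_mul_typeCost_le (hG : G.GoalsReachable) (hstart : ∀ θ, G.goal θ = G.s0 → G.r θ = 0)
    {σ : ι → V → V} (hσ : G.IsDefaultAttacker σ) {H : Finset (List V)} (hH : G.IsFullTree H)
    {x : PrimalVars V ι} (hx : G.PrimalFeasible H x) (hunreached : G.reachedFrontier H x = ∅)
    {π : DefenderStrategy V ι} (hπ : G.IsDefenderStrategy π) (θ : ι) :
    ENNReal.ofReal (x.typ θ) * G.typeCost θ π ((G.finalAttacker H x σ).act θ) ≤
      ENNReal.ofReal (G.restrictedPayoff H π x.z θ) := by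
  have hg := finalAttacker_isPolicy hG hσ hx θ
  have ht := hx.1.1 θ
  set g := (G.finalAttacker H x σ).act θ with hgdef
  -- contribution of the history `h` to the expected cost of type `θ`
  set X : List V → ℝ := fun h =>
    x.typ θ * (histProb g h * ∑ s ∈ G.nbrs (G.pos h), g h s * G.meanStage θ π h s) with hX
  have hXnn : ∀ h, G.IsHist h → 0 ≤ X h := fun h hI =>
    mul_nonneg ht (mul_nonneg (hg.histProb_nonneg hI) (Finset.sum_nonneg fun s hs =>
      mul_nonneg (hg.nonneg hI s) (meanStage_nonneg hπ hI hs)))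
  have hsum : ∀ N, x.typ θ * G.stopSum θ g N (G.meanCost θ π) =
      ∑ n ∈ Finset.range N, ∑ h ∈ G.alive θ n, X h := by
    intro N
    induction N with
    | zero => simp [stopSum_zero, meanCost]
    | succ N ih =>
      rw [stopSum_succ, mul_add, ih, Finset.sum_range_succ, Finset.mul_sum]
      congr 1
      refine Finset.sum_congr rfl fun h hh => ?_
      obtain ⟨h1, h2⟩ := mem_alive.1 hh
      have hI : G.IsHist h := ⟨_, h1⟩
      simp only [hX, meanCost_cons θ π hI.ne_nil, mul_add, Finset.sum_add_distrib]
      rw [← Finset.sum_mul, hg.sum_nbrs hI h2]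
      ring
  have hle : ∀ N, x.typ θ * G.stopSum θ g N (G.meanCost θ π) ≤
      ∑ h ∈ H.filter (fun h => G.goal θ ∉ h), X h := by
    intro N
    have hdisj : (↑(Finset.range N) : Set ℕ).PairwiseDisjoint (G.alive θ) := by
      intro n _ m _ hne
      rw [Function.onFun, Finset.disjoint_left]
      exact fun h hn hm => hne (mem_hist_unique (mem_alive.1 hn).1 (mem_alive.1 hm).1)
    rw [hsum, ← Finset.sum_biUnion hdisj]
    set S := (Finset.range N).biUnion (G.alive θ)
    have hS : ∀ h ∈ S, G.IsHist h ∧ G.goal θ ∉ h := by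
      intro h hh
      obtain ⟨n, -, hn⟩ := Finset.mem_biUnion.1 hh
      exact ⟨⟨n, (mem_alive.1 hn).1⟩, (mem_alive.1 hn).2⟩
    calc ∑ h ∈ S, X h = ∑ h ∈ S.filter (fun h => h ∈ H), X h := by
          refine (Finset.sum_filter_of_ne fun h hh hne => ?_).symm
          by_contra hm
          refine hne ?_
          simp only [hX]
          rw [← mul_assoc, hx.typ_mul_histProb_eq_zero hH hunreached σ θ (hS h hh).1 (hS h hh).2 hm,
            zero_mul]
      _ ≤ _ := by
          refine Finset.sum_le_sum_of_subset_of_nonneg (fun h hh => ?_) fun h hh _ =>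
            hXnn h (hH.isHist h (Finset.mem_filter.1 hh).1)
          obtain ⟨h1, h2⟩ := Finset.mem_filter.1 hh
          exact Finset.mem_filter.2 ⟨h2, (hS h h1).2⟩
  have hpay : ∑ h ∈ H.filter (fun h => G.goal θ ∉ h), X h + x.typ θ * G.r θ ≤
      G.restrictedPayoff H π x.z θ := by
    have e : x.typ θ * G.r θ = ∑ h ∈ H, if h = [G.s0] then x.typ θ * G.r θ else 0 := by
      rw [Finset.sum_ite_eq' H, if_pos hH.root]
    rw [e, Finset.sum_filter, ← Finset.sum_add_distrib]
    refine Finset.sum_le_sum fun h hh => ?_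
    have hI := hH.isHist h hh
    by_cases hgh : G.goal θ ∈ h
    · have h0 : (if h = [G.s0] then x.typ θ * G.r θ else 0) = 0 := by
        split_ifs with e
        · rw [e, List.mem_singleton] at hgh
          rw [hstart θ hgh, mul_zero]
        · rfl
      simp [hgh, h0, stageMatrix_of_mem hgh]
    rw [if_pos hgh]
    have ha := actions_of_notMem hI hgh
    have e1 : ∑ a, π h a * ∑ s ∈ G.actions θ (G.pos h), G.stageMatrix H θ h a s * x.z θ h s =
        ∑ s ∈ G.actions θ (G.pos h), (G.meanStage θ π h s + G.bonus H θ h s) * x.z θ h s := by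
      simp only [← sum_stageMatrix_mul hgh (hπ h hI), Finset.mul_sum, Finset.sum_mul]
      rw [Finset.sum_comm]
      exact Finset.sum_congr rfl fun s _ => Finset.sum_congr rfl fun a _ => by ring
    have e2 : X h = ∑ s ∈ G.actions θ (G.pos h), G.meanStage θ π h s * x.z θ h s := by
      simp only [hX]
      rw [ha, hgdef, hH.histProb_finalAttacker θ hh, finalAttacker_act_of_mem θ hh, ← mul_assoc,
        mul_comm (x.typ θ), hx.histProb_mul_typ hH θ hh, Finset.mul_sum]
      refine Finset.sum_congr rfl fun s _ => ?_
      have := restrictedAct_mul_sum (G := G) (hx.2.2.1 θ h hh) (hx.2.2.2.1 θ h hh) s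
      rw [← mul_assoc, mul_comm _ (G.restrictedAct x θ h s), this, mul_comm]
    rw [e1, e2]
    simp only [add_mul, Finset.sum_add_distrib]
    refine add_le_add le_rfl ?_
    split_ifs with hr
    · subst hr
      rw [← hx.2.1 θ, Finset.sum_mul]
      refine Finset.sum_le_sum fun s _ => ?_
      rw [bonus, if_neg (hH.root_not_frontier hG), if_pos rfl, mul_comm]
    · exact Finset.sum_nonneg fun s _ => mul_nonneg bonus_nonneg (hx.2.2.1 θ h hh s)
  have hCnn : ∀ n, 0 ≤ ∑ h ∈ G.hits θ n, histProb g h * G.meanCost θ π h := fun n =>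
    Finset.sum_nonneg fun h hh =>
      mul_nonneg (hg.histProb_nonneg ⟨n, (mem_hits.1 hh).1⟩)
        (meanCost_nonneg hπ ⟨n, (mem_hits.1 hh).1⟩)
  have hfin : ENNReal.ofReal (x.typ θ) *
      ∑' n, ENNReal.ofReal (∑ h ∈ G.hits θ n, histProb g h * G.meanCost θ π h) ≤
      ENNReal.ofReal (∑ h ∈ H.filter (fun h => G.goal θ ∉ h), X h) := by
    rw [← ENNReal.tsum_mul_left, ENNReal.tsum_eq_iSup_nat]
    refine iSup_le fun N => ?_
    rw [← Finset.mul_sum, ← ENNReal.ofReal_sum_of_nonneg fun n _ => hCnn n,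
      ← ENNReal.ofReal_mul ht]
    refine ENNReal.ofReal_le_ofReal (le_trans (mul_le_mul_of_nonneg_left ?_ ht) (hle N))
    rw [stopSum, Finset.sum_range_succ, add_assoc]
    refine le_add_of_nonneg_right (add_nonneg (hCnn N) (Finset.sum_nonneg fun h hh => ?_))
    have hI : G.IsHist h := ⟨_, (mem_alive.1 hh).1⟩
    exact mul_nonneg (hg.histProb_nonneg hI) (meanCost_nonneg hπ hI)
  rw [typeCost_eq hπ hg, mul_add, ← ENNReal.ofReal_mul ht]
  refine (add_le_add hfin le_rfl).trans ?_
  rw [← ENNReal.ofReal_add _ (mul_nonneg ht (G.r_nonneg θ))]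
  · exact ENNReal.ofReal_le_ofReal hpay
  · exact Finset.sum_nonneg fun h hh => hXnn h (hH.isHist h (Finset.mem_filter.1 hh).1)

/-- Once the algorithm has stopped, the Attacker's strategy guarantees the value of its linear
program in the original game. -/
theorem PrimalFeasible.cost_le (hG : G.GoalsReachable)
    (hstart : ∀ θ, G.goal θ = G.s0 → G.r θ = 0) {σ : ι → V → V} (hσ : G.IsDefaultAttacker σ)
    {H : Finset (List V)} (hH : G.IsFullTree H) {x : PrimalVars V ι} (hx : G.PrimalFeasible H x)
    (hunreached : G.reachedFrontier H x = ∅) {π : DefenderStrategy V ι}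
    (hπ : G.IsDefenderStrategy π) :
    G.cost π (G.finalAttacker H x σ) ≤ ENNReal.ofReal (∑ h ∈ H, x.v h) := by
  refine (Finset.sum_le_sum fun θ _ =>
    typ_mul_typeCost_le hG hstart hσ hH hx hunreached hπ θ).trans ?_
  rw [← ENNReal.ofReal_sum_of_nonneg]
  · refine ENNReal.ofReal_le_ofReal ?_
    simp only [restrictedPayoff]
    rw [Finset.sum_comm]
    refine Finset.sum_le_sum fun h hh => ?_
    have hp := hπ h (hH.isHist h hh)
    rw [Finset.sum_comm]
    calc _ = ∑ a, π h a * ∑ θ, ∑ s ∈ G.actions θ (G.pos h),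
            G.stageMatrix H θ h a s * x.z θ h s := by simp only [Finset.mul_sum]
      _ ≤ ∑ a, π h a * x.v h := Finset.sum_le_sum fun a _ =>
            mul_le_mul_of_nonneg_left (hx.2.2.2.2.1 h hh a) (hp.1 a)
      _ = x.v h := by rw [← Finset.sum_mul, hp.2, one_mul]
  · refine fun θ _ => Finset.sum_nonneg fun h hh => Finset.sum_nonneg fun a _ => ?_
    have hI := hH.isHist h hh
    exact mul_nonneg ((hπ h hI).1 a) (Finset.sum_nonneg fun s hs =>
      mul_nonneg (stageMatrix_nonneg hI hs a) (hx.2.2.1 θ h hh s))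

/-! ### Duality of the linear programs -/

/-- Minimax theorem for a convex set of cost vectors against a product of simplices. -/
theorem exists_stdSimplex_of_convex {κ : Type*} [Fintype κ] [Nonempty κ] {K : Set (κ → ι → ℝ)}
    (hK : Convex ℝ K) (hne : K.Nonempty) {m : ℝ}
    (hm : ∀ u ∈ K, ∀ v : κ → ℝ, (∀ k a, u k a ≤ v k) → m ≤ ∑ k, v k) :
    ∃ p : κ → ι → ℝ, (∀ k, p k ∈ stdSimplex ℝ ι) ∧
      ∀ u ∈ K, m ≤ ∑ k, ∑ a, p k a * u k a := by
  -- the vectors whose maxima over `ι` have a sum less than `m`, written so that `A` is clearly open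
  set A : Set (κ → ι → ℝ) := {u | ∃ v : κ → ℝ, (∀ k a, u k a < v k) ∧ ∑ k, v k < m} with hA
  have hAc : Convex ℝ A := by
    rintro u ⟨v, h1, h2⟩ u' ⟨v', h1', h2'⟩ s t hs ht hst
    have combo : ∀ {a b a' b' : ℝ}, a < b → a' < b' → s * a + t * a' < s * b + t * b' := by
      intro a b a' b' h h'
      rcases hs.eq_or_lt with rfl | hs
      · rw [zero_add] at hst
        simpa [hst] using h'
      · exact add_lt_add_of_lt_of_le (mul_lt_mul_of_pos_left h hs)
          (mul_le_mul_of_nonneg_left h'.le ht)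
    refine ⟨fun k => s * v k + t * v' k, fun k a => combo (h1 k a) (h1' k a), ?_⟩
    rw [Finset.sum_add_distrib, ← Finset.mul_sum, ← Finset.mul_sum]
    calc _ < s * m + t * m := combo h2 h2'
      _ = m := by rw [← add_mul, hst, one_mul]
  have hAo : IsOpen A := by
    have : A = ⋃ v ∈ {v : κ → ℝ | ∑ k, v k < m}, ⋂ k, ⋂ a, {u | u k a < v k} := by
      ext u
      simp only [hA, Set.mem_ofPred_eq, Set.mem_iUnion, Set.mem_iInter, exists_prop]
      exact exists_congr fun v => and_comm
    rw [this]
    exact isOpen_biUnion fun v _ => isOpen_iInter_of_finite fun k =>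
      isOpen_iInter_of_finite fun a => isOpen_lt (by fun_prop) continuous_const
  have hdisj : Disjoint A K := by
    rw [Set.disjoint_left]
    rintro u ⟨v, h1, h2⟩ hu
    exact absurd (hm u hu v fun k a => (h1 k a).le) (not_le.2 h2)
  obtain ⟨φ, c0, hφA, hφK⟩ := geometric_hahn_banach_open hAc hAo hK hdisj
  set c : κ → ι → ℝ := fun k a => φ (Pi.single k (Pi.single a 1)) with hc
  have hφ : ∀ u, φ u = ∑ k, ∑ a, c k a * u k a := by
    intro u
    conv_lhs => rw [← Finset.univ_sum_single u, map_sum]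
    refine Finset.sum_congr rfl fun k _ => ?_
    have : (Pi.single k (u k) : κ → ι → ℝ) = ∑ a, u k a • Pi.single k (Pi.single a (1 : ℝ)) := by
      conv_lhs => rw [← Finset.univ_sum_single (u k)]
      ext k' a'
      by_cases hk : k' = k
      · subst hk
        simp [Finset.sum_apply, Pi.single_apply]
      · simp [Finset.sum_apply, hk]
    rw [this, map_sum]
    exact Finset.sum_congr rfl fun a _ => by rw [map_smul, smul_eq_mul, mul_comm]
  have hcard : (0 : ℝ) < Fintype.card κ := by exact_mod_cast Fintype.card_pos
  have hlt : ∀ (u : κ → ι → ℝ) (v : κ → ℝ), (∀ k a, u k a ≤ v k) → ∑ k, v k < m → φ u < c0 := by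
    intro u v huv hv
    refine hφA u ⟨fun k => v k + (m - ∑ k, v k) / (2 * Fintype.card κ), fun k a => ?_, ?_⟩
    · have : 0 < (m - ∑ k, v k) / (2 * Fintype.card κ) := div_pos (by linarith) (by linarith)
      linarith [huv k a]
    · rw [Finset.sum_add_distrib, Finset.sum_const, nsmul_eq_mul, Finset.card_univ]
      have : (Fintype.card κ : ℝ) * ((m - ∑ k, v k) / (2 * Fintype.card κ)) =
          (m - ∑ k, v k) / 2 := by field_simp
      linarith
  have hltv : ∀ v : κ → ℝ, ∑ k, v k < m → ∑ k, (∑ a, c k a) * v k < c0 := by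
    intro v hv
    have := hlt (fun k _ => v k) v (fun _ _ => le_rfl) hv
    rw [hφ] at this
    simpa only [Finset.sum_mul] using this
  have hconst : ∀ t : ℝ, ∑ _k : κ, t / Fintype.card κ = t := by
    intro t
    rw [Finset.sum_const, nsmul_eq_mul, Finset.card_univ]
    field_simp
  have hpos : ∀ k a, 0 ≤ c k a := by
    intro k a
    by_contra hneg
    rw [not_le] at hneg
    have h0 := hlt (fun _ _ => (m - 1) / Fintype.card κ) _ (fun _ _ => le_rfl)
      (by rw [hconst]; linarith)
    set u0 : κ → ι → ℝ := fun _ _ => (m - 1) / Fintype.card κ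
    -- lowering the entry `(k, a)` by `t` raises `φ` to `c0`
    set t := (c0 - φ u0) / (-c k a)
    have ht : 0 ≤ t := div_nonneg (by linarith) (by linarith)
    have h1 := hlt (u0 + (-t) • (Pi.single k (Pi.single a 1) : κ → ι → ℝ))
      (fun _ => (m - 1) / Fintype.card κ)
      (fun k' a' => by
        have : (0 : ℝ) ≤ (Pi.single k (Pi.single a (1 : ℝ)) : κ → ι → ℝ) k' a' := by
          by_cases hk : k' = k
          · subst hk
            rw [Pi.single_eq_same, Pi.single_apply]
            split_ifs <;> norm_num
          · simp [hk]
        simp only [Pi.add_apply, Pi.smul_apply, smul_eq_mul, u0]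
        nlinarith) (by rw [hconst]; linarith)
    rw [map_add, map_smul, smul_eq_mul] at h1
    have : -t * c k a = c0 - φ u0 := by
      rw [neg_mul_comm, div_mul_cancel₀ _ (neg_ne_zero.2 hneg.ne)]
    simp only [hc] at this
    linarith
  -- `A` is invariant under constant shifts of the rows with total `0`, so `φ` weighs rows equally
  have heq : ∀ k k', ∑ a, c k a = ∑ a, c k' a := by
    intro k k'
    by_contra hne
    have hd : (∑ a, c k a) - ∑ a, c k' a ≠ 0 := sub_ne_zero.2 hne
    set e := ∑ k, (∑ a, c k a) * ((m - 1) / Fintype.card κ)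
    set t := (c0 - e) / ((∑ a, c k a) - ∑ a, c k' a)
    have h1 := hltv (fun j => (m - 1) / Fintype.card κ + (Pi.single k t : κ → ℝ) j -
      (Pi.single k' t : κ → ℝ) j) (by
        rw [Finset.sum_sub_distrib, Finset.sum_add_distrib, hconst]
        simp)
    simp only [mul_sub, mul_add, Finset.sum_sub_distrib, Finset.sum_add_distrib] at h1
    have h2 : ∀ j, ∑ i, (∑ a, c i a) * (Pi.single j t : κ → ℝ) i = (∑ a, c j a) * t := by
      intro j
      rw [Finset.sum_eq_single j]
      · simp
      · intro i _ hi
        simp [hi]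
      · simp
    rw [h2, h2] at h1
    have h3 : ((∑ a, c k a) - ∑ a, c k' a) * t = c0 - e := mul_div_cancel₀ _ hd
    linarith
  obtain ⟨k0⟩ := ‹Nonempty κ›
  set l := ∑ a, c k0 a with hl
  have hl0 : 0 ≤ l := Finset.sum_nonneg fun a _ => hpos k0 a
  have hlm : ∀ t < m, l * t < c0 := by
    intro t ht
    have := hltv (fun _ => t / Fintype.card κ) (by rwa [hconst])
    simp only [heq _ k0] at this
    rwa [← Finset.mul_sum, hconst] at this
  have hlpos : 0 < l := by
    refine lt_of_le_of_ne hl0 fun h0 => ?_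
    have hz : ∀ k a, c k a = 0 := by
      intro k a
      have : ∑ a, c k a = 0 := by rw [heq k k0, ← hl, ← h0]
      exact (Finset.sum_eq_zero_iff_of_nonneg fun a _ => hpos k a).1 this a (Finset.mem_univ a)
    obtain ⟨u, hu⟩ := hne
    have h1 := hφK u hu
    have h2 := hlm (m - 1) (by linarith)
    rw [← h0, zero_mul] at h2
    rw [hφ] at h1
    simp only [hz, zero_mul, Finset.sum_const_zero] at h1
    linarith
  have hmc : l * m ≤ c0 := by
    by_contra hcon
    rw [not_le] at hcon
    have := hlm (c0 / l) (by rwa [div_lt_iff₀ hlpos, mul_comm])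
    rw [mul_div_cancel₀ _ hlpos.ne'] at this
    exact lt_irrefl _ this
  refine ⟨fun k a => c k a / l, fun k => ⟨fun a => div_nonneg (hpos k a) hl0, ?_⟩, fun u hu => ?_⟩
  · rw [← Finset.sum_div, heq k k0, ← hl, div_self hlpos.ne']
  · have h1 := hmc.trans (hφK u hu)
    have h2 : ∑ k, ∑ a, c k a / l * u k a = φ u / l := by
      rw [hφ, Finset.sum_div]
      refine Finset.sum_congr rfl fun k _ => ?_
      rw [Finset.sum_div]
      exact Finset.sum_congr rfl fun a _ => by ring
    rw [h2, le_div_iff₀ hlpos, mul_comm]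
    exact h1

/-- Feasible values of the variables `γ_type` and `z` in the Attacker's linear program. -/
def IsFlow (G : DPPGame V ι) (H : Finset (List V)) (typ : ι → ℝ) (z : ι → List V → V → ℝ) : Prop :=
  typ ∈ stdSimplex ℝ ι ∧
  (∀ θ, ∑ s' ∈ G.actions θ G.s0, z θ [G.s0] s' = typ θ) ∧
  (∀ θ, ∀ h ∈ H, ∀ s', 0 ≤ z θ h s') ∧
  (∀ θ, ∀ h ∈ H, ∀ s', s' ∉ G.actions θ (G.pos h) → z θ h s' = 0) ∧
  (∀ θ, ∀ h ∈ H, ∀ s', s' :: h ∈ H → ∑ s'' ∈ G.actions θ s', z θ (s' :: h) s'' = z θ h s')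

/-- Cost of the Defender's action `a` at the history `h` in the restricted game. -/
noncomputable def payoff (G : DPPGame V ι) (H : Finset (List V)) (z : ι → List V → V → ℝ)
    (h : List V) (a : ι) : ℝ :=
  ∑ θ, ∑ s' ∈ G.actions θ (G.pos h), G.stageMatrix H θ h a s' * z θ h s'

theorem payoff_combo {H : Finset (List V)} (z z' : ι → List V → V → ℝ) (s t : ℝ) (h : List V)
    (a : ι) : G.payoff H (fun θ h s' => s * z θ h s' + t * z' θ h s') h a =
      s * G.payoff H z h a + t * G.payoff H z' h a := by
  simp only [payoff, Finset.mul_sum, ← Finset.sum_add_distrib]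
  exact Finset.sum_congr rfl fun θ _ => Finset.sum_congr rfl fun s' _ => by ring

theorem IsFlow.combo {H : Finset (List V)} {typ typ' : ι → ℝ} {z z' : ι → List V → V → ℝ}
    (h : G.IsFlow H typ z) (h' : G.IsFlow H typ' z') {s t : ℝ} (hs : 0 ≤ s) (ht : 0 ≤ t)
    (hst : s + t = 1) :
    G.IsFlow H (s • typ + t • typ') (fun θ h s' => s * z θ h s' + t * z' θ h s') := by
  refine ⟨convex_stdSimplex ℝ ι h.1 h'.1 hs ht hst, fun θ => ?_, fun θ k hk s' => ?_,
    fun θ k hk s' hs' => ?_, fun θ k hk s' hs' => ?_⟩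
  · rw [Finset.sum_add_distrib, ← Finset.mul_sum, ← Finset.mul_sum, h.2.1, h'.2.1]
    rfl
  · exact add_nonneg (mul_nonneg hs (h.2.2.1 θ k hk s')) (mul_nonneg ht (h'.2.2.1 θ k hk s'))
  · dsimp only
    rw [h.2.2.2.1 θ k hk s' hs', h'.2.2.2.1 θ k hk s' hs']
    ring
  · rw [Finset.sum_add_distrib, ← Finset.mul_sum, ← Finset.mul_sum, h.2.2.2.2 θ k hk s' hs',
      h'.2.2.2.2 θ k hk s' hs']

/-- A strategy of the Defender that guarantees the value of the Attacker's linear program in the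
restricted game. -/
theorem PrimalOptimal.exists_defender {H : Finset (List V)} (hroot : [G.s0] ∈ H)
    {x : PrimalVars V ι} (hx : G.PrimalOptimal H x) :
    ∃ p : List V → ι → ℝ, (∀ h ∈ H, p h ∈ stdSimplex ℝ ι) ∧ ∀ typ z, G.IsFlow H typ z →
      ∑ h ∈ H, x.v h ≤ ∑ h ∈ H, ∑ a, p h a * G.payoff H z h a := by
  set K : Set (H → ι → ℝ) :=
    {u | ∃ typ z, G.IsFlow H typ z ∧ u = fun (h : H) a => G.payoff H z h.1 a} with hK
  have : Nonempty H := ⟨⟨_, hroot⟩⟩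
  have hKc : Convex ℝ K := by
    rintro _ ⟨typ, z, h, rfl⟩ _ ⟨typ', z', h', rfl⟩ s t hs ht hst
    refine ⟨_, _, h.combo h' hs ht hst, ?_⟩
    funext k a
    rw [payoff_combo]
    rfl
  have hKne : K.Nonempty := ⟨_, x.typ, x.z, ⟨hx.1.1, hx.1.2.1, hx.1.2.2.1, hx.1.2.2.2.1,
    hx.1.2.2.2.2.2⟩, rfl⟩
  obtain ⟨p, hp, hpK⟩ := exists_stdSimplex_of_convex hKc hKne (m := ∑ h ∈ H, x.v h) (by
    rintro _ ⟨typ, z, h, rfl⟩ v hv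
    have := hx.2 ⟨typ, z, fun k => if hk : k ∈ H then v ⟨k, hk⟩ else 0⟩ ⟨h.1, h.2.1, h.2.2.1,
      h.2.2.2.1, fun k hk a => by simpa [hk, payoff] using hv ⟨k, hk⟩ a, h.2.2.2.2⟩
    refine this.trans_eq ?_
    rw [← Finset.sum_coe_sort]
    exact Finset.sum_congr rfl fun k _ => by simp)
  refine ⟨fun h => if hh : h ∈ H then p ⟨h, hh⟩ else 0, fun h hh => by simpa [hh] using hp ⟨h, hh⟩,
    fun typ z hz => ?_⟩
  refine (hpK _ ⟨typ, z, hz, rfl⟩).trans_eq ?_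
  rw [← Finset.sum_coe_sort H]
  exact Finset.sum_congr rfl fun k _ => by simp

/-- A sum over a tree of histories is the value at the root plus the sum over all children. -/
theorem IsFullTree.sum_eq {H : Finset (List V)} (hH : G.IsFullTree H) (F : List V → ℝ) :
    ∑ h ∈ H, F h = F [G.s0] + ∑ h ∈ H, ∑ s, if s :: h ∈ H then F (s :: h) else 0 := by
  rw [← Finset.add_sum_erase H F hH.root]
  congr 1
  have e : H.erase [G.s0] = H.biUnion fun h =>
      (Finset.univ.filter fun s => s :: h ∈ H).image fun s => s :: h := by
    ext k
    simp only [Finset.mem_erase, Finset.mem_biUnion, Finset.mem_image, Finset.mem_filter,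
      Finset.mem_univ, true_and]
    constructor
    · rintro ⟨hne, hk⟩
      obtain ⟨n, hn⟩ := hH.isHist k hk
      cases n with
      | zero => exact absurd (mem_hist_zero.1 hn) hne
      | succ n =>
        obtain ⟨h, hh, s, -, rfl⟩ := mem_hist_succ.1 hn
        exact ⟨h, hH.tail h s (IsHist.ne_nil ⟨n, hh⟩) hk, s, hk, rfl⟩
    · rintro ⟨h, hh, s, hs, rfl⟩
      exact ⟨fun e => (hH.isHist h hh).ne_nil (List.cons.inj e).2, hs⟩
  rw [e, Finset.sum_biUnion]
  · refine Finset.sum_congr rfl fun h _ => ?_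
    rw [Finset.sum_image fun a _ b _ hab => (List.cons.inj hab).1, Finset.sum_filter]
  · intro h _ k _ hne
    rw [Function.onFun, Finset.disjoint_left]
    intro l hl hl'
    simp only [Finset.mem_image] at hl hl'
    obtain ⟨a, -, rfl⟩ := hl
    obtain ⟨b, -, e⟩ := hl'
    exact hne (List.cons.inj e).2.symm

/-- Backward induction over at most `n` steps: the least total cost, for the costs `c h s`, of type
`θ` in the restricted game when it starts at a given history. -/
noncomputable def bestValue (G : DPPGame V ι) (H : Finset (List V)) (θ : ι)
    (c : List V → V → ℝ) : ℕ → List V → ℝ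
  | 0, _ => 0
  | n + 1, h => if hne : (G.actions θ (G.pos h)).Nonempty then
      (G.actions θ (G.pos h)).inf' hne
        fun s => c h s + if G.IsFinal H θ h then 0 else bestValue G H θ c n (s :: h)
    else 0

/-- Solution of the dynamic programming equations of type `θ` in the restricted game, with an
optimal deterministic policy `α`. -/
theorem IsFullTree.exists_bestResponse (hG : G.GoalsReachable) {H : Finset (List V)}
    (hH : G.IsFullTree H) (θ : ι) (c : List V → V → ℝ) :
    ∃ (q : List V → ℝ) (α : List V → V), ∀ h ∈ H, α h ∈ G.actions θ (G.pos h) ∧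
      (∀ s ∈ G.actions θ (G.pos h), q h ≤ c h s + if G.IsFinal H θ h then 0 else q (s :: h)) ∧
      q h = c h (α h) + if G.IsFinal H θ h then 0 else q (α h :: h) := by
  set L := H.sup List.length
  set q : List V → ℝ := fun h => G.bestValue H θ c (L + 1 - h.length) h with hq
  have hne : ∀ h ∈ H, (G.actions θ (G.pos h)).Nonempty := fun h hh =>
    hG.actions_nonempty (hH.isHist h hh) θ
  have hqe : ∀ h (hh : h ∈ H), q h = (G.actions θ (G.pos h)).inf' (hne h hh)
      fun s => c h s + if G.IsFinal H θ h then 0 else q (s :: h) := by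
    intro h hh
    have hl : h.length ≤ L := Finset.le_sup (f := List.length) hh
    have e : L + 1 - h.length = (L - h.length) + 1 := by omega
    simp only [hq, List.length_cons, Nat.add_sub_add_right]
    rw [e, bestValue, dif_pos (hne h hh)]
  have hα : ∀ h, ∃ s, h ∈ H → s ∈ G.actions θ (G.pos h) ∧
      q h = c h s + if G.IsFinal H θ h then 0 else q (s :: h) := by
    intro h
    by_cases hh : h ∈ H
    · obtain ⟨s, hs, e⟩ := Finset.exists_mem_eq_inf' (hne h hh)
        (fun s => c h s + if G.IsFinal H θ h then 0 else q (s :: h))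
      exact ⟨s, fun _ => ⟨hs, (hqe h hh).trans e⟩⟩
    · exact ⟨G.s0, fun h' => absurd h' hh⟩
  choose α hα using hα
  refine ⟨q, α, fun h hh => ⟨(hα h hh).1, fun s hs => ?_, (hα h hh).2⟩⟩
  rw [hqe h hh]
  exact Finset.inf'_le _ hs

theorem histProb_nonneg_of_nonneg {g : List V → V → ℝ} (hg : ∀ h s, 0 ≤ g h s) (h : List V) :
    0 ≤ histProb g h := by
  induction h with
  | nil => simp [histProb]
  | cons s h ih =>
    cases h with
    | nil => simp [histProb]
    | cons t h => exact mul_nonneg ih (hg _ _)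

/-- Strong duality: the Defender's linear program attains the optimal value of the Attacker's. -/
theorem PrimalOptimal.exists_dualFeasible (hG : G.GoalsReachable) {H : Finset (List V)}
    (hH : G.IsFullTree H) {x : PrimalVars V ι} (hx : G.PrimalOptimal H x) :
    ∃ y, G.DualFeasible H y ∧ ∑ h ∈ H, x.v h ≤ y.U := by
  obtain ⟨p, hp, hpm⟩ := hx.exists_defender hH.root
  choose q α hα using fun θ => hH.exists_bestResponse hG θ
    (fun h s => ∑ a, G.stageMatrix H θ h a s * p h a)
  obtain ⟨ψ, -, hψ⟩ := Finset.exists_min_image (Finset.univ : Finset ι)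
    (fun θ => q θ [G.s0]) Finset.univ_nonempty
  refine ⟨⟨p, q, q ψ [G.s0]⟩, ⟨hp, fun θ => hψ θ (Finset.mem_univ θ), ?_, ?_⟩, ?_⟩
  · intro θ h hh hf s hs
    simpa [hf] using (hα θ h hh).2.1 s hs
  · intro θ h hf s hs
    simpa [hf] using (hα θ h hf.1).2.1 s hs
  -- the best response of the cheapest type `ψ` is a feasible flow of cost `q ψ [s0]`
  set g : List V → V → ℝ := fun h s => if s = α ψ h then 1 else 0 with hg
  set c : List V → V → ℝ := fun h s => ∑ a, G.stageMatrix H ψ h a s * p h a with hc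
  have hg0 : ∀ h s, 0 ≤ g h s := by
    intro h s
    simp only [hg]
    split_ifs <;> norm_num
  have hg1 : ∀ h ∈ H, ∑ s ∈ G.actions ψ (G.pos h), g h s = 1 := by
    intro h hh
    simp [hg, (hα ψ h hh).1]
  set z : ι → List V → V → ℝ := fun θ h s => if θ = ψ then histProb g h * g h s else 0 with hz
  have hflow : G.IsFlow H (Pi.single ψ 1) z := by
    refine ⟨single_mem_stdSimplex ℝ ψ, fun θ => ?_, fun θ h hh s => ?_, fun θ h hh s hs => ?_,
      fun θ h hh s hs => ?_⟩
    · by_cases hθ : θ = ψ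
      · subst hθ
        simpa [hz, histProb] using hg1 _ hH.root
      · simp [hz, hθ]
    · simp only [hz]
      split_ifs
      · exact mul_nonneg (histProb_nonneg_of_nonneg hg0 h) (hg0 h s)
      · exact le_rfl
    · by_cases hθ : θ = ψ
      · subst hθ
        have : s ≠ α θ h := fun e => hs (e ▸ (hα θ h hh).1)
        simp [hz, hg, this]
      · simp [hz, hθ]
    · by_cases hθ : θ = ψ
      · subst hθ
        have := hg1 _ hs
        rw [pos_cons] at this
        simp only [hz, if_true]
        rw [← Finset.mul_sum, this, mul_one, histProb_cons g (hH.isHist h hh).ne_nil]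
      · simp [hz, hθ]
  refine (hpm _ _ hflow).trans_eq ?_
  have hterm : ∀ h ∈ H, G.goal ψ ∈ h → q ψ h = 0 := by
    intro h hh hgh
    have hf : G.IsFinal H ψ h := ⟨hh, Or.inl hgh⟩
    rw [(hα ψ h hh).2.2, if_pos hf]
    simp [stageMatrix_of_mem hgh]
  have hpay : ∀ h ∈ H, ∑ a, p h a * G.payoff H z h a = histProb g h * c h (α ψ h) := by
    intro h hh
    have e : ∀ a, G.payoff H z h a = histProb g h * G.stageMatrix H ψ h a (α ψ h) := by
      intro a
      rw [payoff, Finset.sum_eq_single ψ]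
      · rw [Finset.sum_eq_single (α ψ h)]
        · simp [hz, hg, mul_comm]
        · intro s _ hs
          simp [hz, hg, hs]
        · exact fun hs => absurd (hα ψ h hh).1 hs
      · intro θ _ hθ
        simp [hz, hθ]
      · simp
    simp only [e, hc, Finset.mul_sum]
    exact Finset.sum_congr rfl fun a _ => by ring
  have hstep : ∀ h ∈ H, histProb g h * c h (α ψ h) = histProb g h * q ψ h -
      ∑ s, if s :: h ∈ H then histProb g (s :: h) * q ψ (s :: h) else 0 := by
    intro h hh
    have e : (∑ s, if s :: h ∈ H then histProb g (s :: h) * q ψ (s :: h) else 0) =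
        histProb g h * if α ψ h :: h ∈ H then q ψ (α ψ h :: h) else 0 := by
      rw [Finset.sum_eq_single (α ψ h)]
      · rw [histProb_cons g (hH.isHist h hh).ne_nil]
        simp [hg]
      · intro s _ hs
        rw [histProb_cons g (hH.isHist h hh).ne_nil]
        simp [hg, hs]
      · simp
    rw [e, ← mul_sub, (hα ψ h hh).2.2]
    congr 1
    by_cases hf : G.IsFinal H ψ h
    · rw [if_pos hf]
      have : (if α ψ h :: h ∈ H then q ψ (α ψ h :: h) else 0) = 0 := by
        split_ifs with hm
        · rcases hf.2 with hgh | hfr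
          · exact hterm _ hm (List.mem_cons_of_mem _ hgh)
          · exact absurd hm (hfr.2.2 _)
        · rfl
      rw [this]
      ring
    · obtain ⟨h1, h2⟩ := (not_isFinal_iff hh).1 hf
      have ha := (hα ψ h hh).1
      rw [actions_of_notMem (hH.isHist h hh) h1] at ha
      rw [if_neg hf, if_pos (hH.cons_mem hh h1 h2 ha)]
      ring
  rw [Finset.sum_congr rfl hpay, Finset.sum_congr rfl hstep, Finset.sum_sub_distrib,
    hH.sum_eq fun h => histProb g h * q ψ h]
  simp [histProb]

end

end DPPGame

theorem proposition1 {V ι : Type*} [Fintype V] [Fintype ι] [LinearOrder ι] [Nonempty ι]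
    (G : DPPGame V ι)
    (hreach : ∀ s, Relation.ReflTransGen G.edge G.s0 s →
      ∀ θ, Relation.ReflTransGen G.edge s (G.goal θ))
    (hstart : ∀ θ, G.goal θ = G.s0 → G.r θ = 0)
    (σ : ι → V → V) (hσ : G.IsDefaultAttacker σ)
    (τ : ℕ) (hτ : 0 < τ)
    (H : Finset (List V)) (x : PrimalVars V ι) (y : DualVars V ι)
    (hout : G.Output τ H x y) :
    G.IsNash (G.finalDefender H y) (G.finalAttacker H x σ) ∧
      G.cost (G.finalDefender H y) (G.finalAttacker H x σ) ≠ ⊤ := by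
  obtain ⟨hrun, hunreached, hy, hyopt⟩ := hout
  obtain ⟨hH, hx⟩ := hrun.isFullTree hτ
  obtain ⟨y', hy', hle⟩ := hx.exists_dualFeasible hreach hH
  have hval : ENNReal.ofReal (∑ h ∈ H, x.v h) ≤ ENNReal.ofReal y.U :=
    ENNReal.ofReal_le_ofReal (hle.trans (hyopt y' hy'))
  have hπ := DPPGame.finalDefender_isDefenderStrategy hy
  have hγ := DPPGame.finalAttacker_isAttackerStrategy hreach hσ hx.1
  have upper : ∀ π, G.IsDefenderStrategy π →
      G.cost π (G.finalAttacker H x σ) ≤ ENNReal.ofReal (∑ h ∈ H, x.v h) :=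
    fun π hπ => hx.1.cost_le hreach hstart hσ hH hunreached hπ
  have lower : ∀ γ, G.IsAttackerStrategy γ →
      ENNReal.ofReal y.U ≤ G.cost (G.finalDefender H y) γ :=
    fun γ hγ => hy.le_cost hreach hH hγ
  exact ⟨⟨hπ, hγ, fun π hπ => (upper π hπ).trans (hval.trans (lower _ hγ)),
    fun γ hγ => (upper _ hπ).trans (hval.trans (lower γ hγ))⟩,
    ne_top_of_le_ne_top ENNReal.ofReal_ne_top (upper _ hπ)⟩
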